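/- Let $k$ be an infinite field, $H$ a Hopf algebra over $k$ (coproduct $\Delta(x)=x_1\otimes x_2$, counit $\varepsilon$), and $\alpha:H\times H\to k$ a normalized two-cocycle with convolution inverse $\alpha^{-1}$, i.e. $\alpha(x_1,y_1)\,\alpha(x_2y_2,z)=\alpha(y_1,z_1)\,\alpha(x,y_2z_2)$ and $\alpha(x,1)=\alpha(1,x)=\varepsilon(x)$. Let ${}^{\alpha}H$ be the algebra with underlying vector space $\{u_x : x\in H\}$ (a copy of $H$) and product $u_xu_y=\alpha(x_1,y_1)\,u_{x_2y_2}$; it is a right $H$-comodule algebra with coaction $u_x\mapsto u_{x_1}\otimes x_2$. Assume that $\alpha$ is non-degenerate, i.e. that the center of ${}^{\alpha}H$ is one-dimensional over $k$. Let $X_H$ be a copy of the vector space $H$ (with $x\mapsto X_x$); the tensor algebra $T(X_H)$ is an $H$-comodule algebra with coaction $X_x\mapsto X_{x_1}\otimes x_2$. Let $I_H^\alpha$ be the intersection of the kernels of all $H$-comodule algebra maps $T(X_H)\to{}^{\alpha}H$, let $\mathcal U=\mathcal U_H^\alpha=T(X_H)/I_H^\alpha$ with the induced coaction $\delta$, and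 let $\mathcal Z=\mathcal Z_H^\alpha$ be the center of $\mathcal U$. Let $S(t_H)$ be the symmetric algebra of a copy of $H$ (with $x\mapsto t_x$), and let $\mu_\alpha:T(X_H)\to S(t_H)\otimes{}^{\alpha}H$ be the algebra map $X_x\mapsto t_{x_1}\otimes u_{x_2}$. The linear map $x\mapsto t_x$ from $H$ to $\operatorname{Frac}S(t_H)$ is convolution-invertible; let $x\mapsto t^{-1}_x$ be its inverse. The generic base algebra $\mathcal B=\mathcal B_H^\alpha$ is the $k$-subalgebra of $\operatorname{Frac}S(t_H)$ generated by all $$\sigma(x,y)=t_{x_1}t_{y_1}\,\alpha(x_2,y_2)\,t^{-1}_{x_3y_3},\qquad \sigma^{-1}(x,y)=t_{x_1y_1}\,\alpha^{-1}(x_2,y_2)\,t^{-1}_{x_3}t^{-1}_{y_3}\qquad(x,y\in H).$$ Theorem. (1) There is an algebra map $\iota:\mathcal Z\to\mathcal B$ such that, for every $P\in T(X_H)$ whose class $z\in\mathcal U$ is central, $\mu_\alpha(P)=\iota(z)\otimes u_1$ with $\iota(z)\in S(t_H)$. (2) Suppose that $\iota$ makes $\mathcal B$ a localization of $\mathcal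 Z$, i.e. identifies $\mathcal B$ with $M^{-1}\mathcal Z$ for some multiplicative subset $M\subset\mathcal Z$. Then $\mathcal A=\mathcal B\otimes_{\mathcal Z}\mathcal U$ is an $H$-comodule algebra with coaction extending $\delta$ and trivial on $\mathcal B$, and it is a cleft $H$-Galois extension of $\mathcal B$: the map $\mathcal B\to\mathcal A$ is injective with image the subalgebra of coinvariants of $\mathcal A$, the canonical map $\mathcal A\otimes_{\mathcal B}\mathcal A\to\mathcal A\otimes H$, $a\otimes a'\mapsto(a\otimes1)\,\delta(a')$, is bijective, and there is a convolution-invertible $H$-comodule map $H\to\mathcal A$. In particular there is a $\mathcal B$-linear isomorphism of $H$-comodules $\mathcal A\cong\mathcal B\otimes H$; moreover the center of $\mathcal A$ is $\mathcal B$, and $\mathcal A$ is free of rank $\dim_kH$ over it. -/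

import Mathlib

open scoped TensorProduct

universe u v w

noncomputable section

namespace HopfIdent

/-! ### Comodule algebras, cleft and Galois extensions -/

/-- A (right) `H`-comodule algebra structure on the `k`-algebra `A`: a coassociative and counital
coaction `δ : A → A ⊗ H` which is an algebra map. -/
class ComoduleAlgebra (k : Type u) (H : Type v) (A : Type w) [Field k] [Ring H] [HopfAlgebra k H]
    [Ring A] [Algebra k A] where
  coaction : A →ₐ[k] A ⊗[k] H
  coassoc : ∀ a : A, TensorProduct.assoc k A H H (coaction.toLinearMap.rTensor H (coaction a)) =
    (Coalgebra.comul (R := k) (A := H)).lTensor A (coaction a)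
  counit : ∀ a : A, (Coalgebra.counit (R := k) (A := H)).lTensor A (coaction a) = a ⊗ₜ 1

section General

variable (k : Type u) (H : Type v) [Field k] [Ring H] [HopfAlgebra k H]

/-- The coaction `δ : A → A ⊗ H` of an `H`-comodule algebra `A`. -/
def coaction (A : Type w) [Ring A] [Algebra k A] [ComoduleAlgebra k H A] : A →ₐ[k] A ⊗[k] H :=
  ComoduleAlgebra.coaction

/-- The subalgebra `A^H = {a | δ a = a ⊗ 1}` of coinvariants. -/
def coinvariants (A : Type w) [Ring A] [Algebra k A] [ComoduleAlgebra k H A] : Subalgebra k A :=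
  AlgHom.equalizer (coaction k H A) Algebra.TensorProduct.includeLeft

/-- An algebra map `f : A → A'` is a comodule algebra map if `δ' ∘ f = (f ⊗ id) ∘ δ`. -/
def IsComoduleAlgHom {A A' : Type*} [Ring A] [Algebra k A] [ComoduleAlgebra k H A]
    [Ring A'] [Algebra k A'] [ComoduleAlgebra k H A'] (f : A →ₐ[k] A') : Prop :=
  ∀ a : A, coaction k H A' (f a) = f.toLinearMap.rTensor H (coaction k H A a)

section Extension

variable (B A : Type*) [CommRing B] [Ring A] [Algebra k A] [Algebra B A]
  [ComoduleAlgebra k H A]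

variable {B A} in
/-- The canonical map `A ⊗_B A → A ⊗ H`, `a ⊗ a' ↦ (a ⊗ 1) δ(a')`, for a commutative ring `B`
acting centrally on `A` through coinvariant elements. -/
def canonicalMap (hB : ∀ b : B, algebraMap B A b ∈ coinvariants k H A) :
    A ⊗[B] A →+ A ⊗[k] H :=
  TensorProduct.liftAddHom
    ((AddMonoidHom.mul (R := A ⊗[k] H)).comp
      (Algebra.TensorProduct.includeLeft : A →ₐ[k] A ⊗[k] H).toAddMonoidHom |>.compr₂
        (AddMonoidHom.id _) |>.compl₂ (coaction k H A).toAddMonoidHom)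
    (by
      intro b a a'
      have h : coaction k H A (algebraMap B A b) = algebraMap B A b ⊗ₜ 1 := hB b
      have e : (a * algebraMap B A b) ⊗ₜ[k] (1 : H) = a ⊗ₜ 1 * algebraMap B A b ⊗ₜ 1 := by simp
      change (b • a) ⊗ₜ[k] (1 : H) * coaction k H A a' = a ⊗ₜ 1 * coaction k H A (b • a')
      rw [Algebra.smul_def, Algebra.smul_def, Algebra.commutes b a, e, map_mul, h, mul_assoc])

variable {B A} in
theorem canonicalMap_tmul (hB : ∀ b : B, algebraMap B A b ∈ coinvariants k H A) (a a' : A) :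
    canonicalMap k H hB (a ⊗ₜ a') = a ⊗ₜ 1 * coaction k H A a' := rfl

/-- `A` is an `H`-Galois extension of the commutative ring `B`, embedded in the center of `A`:
the coinvariants of `A` are `B`, and the canonical map `A ⊗_B A → A ⊗ H` is bijective. -/
structure IsGaloisExtension : Prop where
  injective : Function.Injective (algebraMap B A)
  coinvariant : ∀ b : B, algebraMap B A b ∈ coinvariants k H A
  surjective : ∀ a ∈ coinvariants k H A, ∃ b : B, algebraMap B A b = a
  bijective : Function.Bijective (canonicalMap k H coinvariant)


/-- A `B`-linear isomorphism `e : A ≃ B ⊗ H` is a comodule isomorphism if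
`(e ⊗ id) ∘ δ = (id ⊗ Δ) ∘ e`. -/
def IsComoduleEquiv [Algebra k B] [IsScalarTower k B A] (e : A ≃ₗ[B] B ⊗[k] H) : Prop :=
  ∀ a : A, (e.restrictScalars k).toLinearMap.rTensor H (coaction k H A a) =
    (TensorProduct.assoc k B H H).symm
      ((Coalgebra.comul (R := k) (A := H)).lTensor B (e a))

/-- `A` is cleft: there is a convolution-invertible comodule map `j : H → A`. -/
def IsCleft : Prop :=
  ∃ j : H →ₗ[k] A, IsUnit (WithConv.toConv j) ∧
    ∀ x : H, coaction k H A (j x) = j.rTensor H (Coalgebra.comul x)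

end Extension

end General

/-! ### The center of an algebra -/

section Center

variable (k : Type*) [Field k] (U : Type*) [Ring U] [Algebra k U]

/-- The center of the `k`-algebra `U`, as a commutative `k`-algebra. -/
def Center : Type _ := Subalgebra.center k U

instance : CommRing (Center k U) := inferInstanceAs (CommRing (Subalgebra.center k U))

/-- The inclusion of the center, as a ring map. -/
def Center.valRingHom : Center k U →+* U := (Subalgebra.center k U).val.toRingHom

theorem Center.valRingHom_commute (z : Center k U) (x : U) :
    Center.valRingHom k U z * x = x * Center.valRingHom k U z :=
  (Subalgebra.mem_center_iff.1 z.2 x).symm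

instance : Algebra k (Center k U) :=
  RingHom.toAlgebra (algebraMap k (Subalgebra.center k U))

instance : Algebra (Center k U) U :=
  RingHom.toAlgebra' (Center.valRingHom k U) (Center.valRingHom_commute k U)

instance : IsScalarTower k (Center k U) U :=
  .of_algebraMap_eq fun _ => rfl

end Center

/-! ### The tensor algebra, `H`-identities and the universal comodule algebra -/

section Identities

variable (k : Type u) (H : Type v) [Field k] [Ring H] [HopfAlgebra k H]

variable {k H} in
theorem coassoc_of_comp {V A : Type*} [AddCommGroup V] [Module k V] [AddCommGroup A] [Module k A]
    (ρ : V →ₗ[k] V ⊗[k] H) (δ : A →ₗ[k] A ⊗[k] H) (f : V →ₗ[k] A)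
    (hf : ∀ v, δ (f v) = f.rTensor H (ρ v)) (v : V)
    (hρ : TensorProduct.assoc k V H H (ρ.rTensor H (ρ v)) =
      (Coalgebra.comul (R := k) (A := H)).lTensor V (ρ v)) :
    TensorProduct.assoc k A H H (δ.rTensor H (δ (f v))) =
      (Coalgebra.comul (R := k) (A := H)).lTensor A (δ (f v)) := by
  have h₁ : ∀ c : V ⊗[k] H, TensorProduct.assoc k A H H (δ.rTensor H (f.rTensor H c)) =
      f.rTensor (H ⊗[k] H) (TensorProduct.assoc k V H H (ρ.rTensor H c)) := by
    intro c
    induction c with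
    | zero => simp
    | add a b ha hb => simp only [map_add, ha, hb]
    | tmul w h =>
      simp only [LinearMap.rTensor_tmul, hf]
      induction ρ w with
      | zero => simp
      | add a b ha hb => simp only [map_add, TensorProduct.add_tmul, ha, hb]
      | tmul a b => simp
  have h₂ : ∀ c : V ⊗[k] H, (Coalgebra.comul (R := k) (A := H)).lTensor A (f.rTensor H c) =
      f.rTensor (H ⊗[k] H) ((Coalgebra.comul (R := k) (A := H)).lTensor V c) := by
    intro c
    induction c with
    | zero => simp
    | add a b ha hb => simp only [map_add, ha, hb]
    | tmul w h => simp
  rw [hf, h₁, h₂, hρ]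

variable {k H} in
theorem counit_of_comp {V A : Type*} [AddCommGroup V] [Module k V] [AddCommGroup A] [Module k A]
    (ρ : V →ₗ[k] V ⊗[k] H) (δ : A →ₗ[k] A ⊗[k] H) (f : V →ₗ[k] A)
    (hf : ∀ v, δ (f v) = f.rTensor H (ρ v)) (v : V)
    (hρ : (Coalgebra.counit (R := k) (A := H)).lTensor V (ρ v) = v ⊗ₜ 1) :
    (Coalgebra.counit (R := k) (A := H)).lTensor A (δ (f v)) = f v ⊗ₜ 1 := by
  have h₂ : ∀ c : V ⊗[k] H, (Coalgebra.counit (R := k) (A := H)).lTensor A (f.rTensor H c) =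
      f.rTensor k ((Coalgebra.counit (R := k) (A := H)).lTensor V c) := by
    intro c
    induction c with
    | zero => simp
    | add a b ha hb => simp only [map_add, ha, hb]
    | tmul w h => simp
  rw [hf, h₂, hρ, LinearMap.rTensor_tmul]

variable {k H} in
theorem coassocHom_apply {A : Type w} [Ring A] [Algebra k A] (δ : A →ₐ[k] A ⊗[k] H) (a : A) :
    ((Algebra.TensorProduct.assoc k k k A H H).toAlgHom.comp
      (Algebra.TensorProduct.map δ (AlgHom.id k H))).comp δ a =
      TensorProduct.assoc k A H H (δ.toLinearMap.rTensor H (δ.toLinearMap a)) := rfl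

variable {k H} in
theorem comulHom_apply {A : Type w} [Ring A] [Algebra k A] (δ : A →ₐ[k] A ⊗[k] H) (a : A) :
    (Algebra.TensorProduct.map (AlgHom.id k A) (Bialgebra.comulAlgHom k H)).comp δ a =
      (Coalgebra.comul (R := k) (A := H)).lTensor A (δ.toLinearMap a) := rfl

variable {k H} in
theorem counitHom_apply {A : Type w} [Ring A] [Algebra k A] (δ : A →ₐ[k] A ⊗[k] H) (a : A) :
    (Algebra.TensorProduct.map (AlgHom.id k A) (Bialgebra.counitAlgHom k H)).comp δ a =
      (Coalgebra.counit (R := k) (A := H)).lTensor A (δ.toLinearMap a) := rfl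

/-- A comodule algebra structure from a coaction whose axioms are equalities of algebra maps. -/
abbrev ComoduleAlgebra.ofAlgHom {A : Type w} [Ring A] [Algebra k A] (δ : A →ₐ[k] A ⊗[k] H)
    (h₁ : ((Algebra.TensorProduct.assoc k k k A H H).toAlgHom.comp
      (Algebra.TensorProduct.map δ (AlgHom.id k H))).comp δ =
      (Algebra.TensorProduct.map (AlgHom.id k A) (Bialgebra.comulAlgHom k H)).comp δ)
    (h₂ : (Algebra.TensorProduct.map (AlgHom.id k A) (Bialgebra.counitAlgHom k H)).comp δ =
      Algebra.TensorProduct.includeLeft) : ComoduleAlgebra k H A where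
  coaction := δ
  coassoc a := DFunLike.congr_fun h₁ a
  counit a := DFunLike.congr_fun h₂ a

/-- The coaction `X_x ↦ X_{x₁} ⊗ x₂` on the tensor algebra `T(X_H)`. -/
def tensorCoaction : TensorAlgebra k H →ₐ[k] TensorAlgebra k H ⊗[k] H :=
  TensorAlgebra.lift k ((TensorAlgebra.ι k).rTensor H ∘ₗ Coalgebra.comul)

variable {k H} in
theorem tensorCoaction_ι (x : H) : (tensorCoaction k H).toLinearMap (TensorAlgebra.ι k x) =
    (TensorAlgebra.ι k).rTensor H (Coalgebra.comul x) :=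
  TensorAlgebra.lift_ι_apply _ x

variable {k H} in
theorem tensor_hom_ext {A : Type w} [Ring A] [Algebra k A] (f g : TensorAlgebra k H →ₐ[k] A)
    (h : ∀ x : H, f (TensorAlgebra.ι k x) = g (TensorAlgebra.ι k x)) : f = g :=
  TensorAlgebra.hom_ext (LinearMap.ext h)

instance : ComoduleAlgebra k H (TensorAlgebra k H) := by
  refine .ofAlgHom k H (tensorCoaction k H) ?_ ?_
  · refine tensor_hom_ext _ _ fun x => ?_
    refine (coassocHom_apply _ _).trans (Eq.trans ?_ (comulHom_apply _ _).symm)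
    refine coassoc_of_comp Coalgebra.comul (tensorCoaction k H).toLinearMap
      (TensorAlgebra.ι k) ?_ x ?_
    · exact tensorCoaction_ι
    · exact Coalgebra.coassoc_apply x
  · refine tensor_hom_ext _ _ fun x => ?_
    refine (counitHom_apply _ _).trans ?_
    refine counit_of_comp Coalgebra.comul (tensorCoaction k H).toLinearMap
      (TensorAlgebra.ι k) ?_ x ?_
    · exact tensorCoaction_ι
    · exact Coalgebra.lTensor_counit_comul x

variable (A : Type w) [Ring A] [Algebra k A] [ComoduleAlgebra k H A]

/-- The ideal `I_H(A)` of `H`-identities for `A`: the elements of `T(X_H)` killed by all comodule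
algebra maps `T(X_H) → A`. -/
def identities : Ideal (TensorAlgebra k H) :=
  ⨅ μ : {μ : TensorAlgebra k H →ₐ[k] A // IsComoduleAlgHom k H μ}, RingHom.ker μ.1

variable {k H A} in
theorem mem_identities {P : TensorAlgebra k H} : P ∈ identities k H A ↔
    ∀ μ : TensorAlgebra k H →ₐ[k] A, IsComoduleAlgHom k H μ → μ P = 0 := by
  simp [identities, RingHom.mem_ker]

instance : (identities k H A).IsTwoSided :=
  ⟨fun b h => mem_identities.2 fun μ hμ => by simp [mem_identities.1 h μ hμ]⟩

/-- The universal comodule algebra `U_H(A) = T(X_H) / I_H(A)`. -/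
def Universal : Type (max u v) := TensorAlgebra k H ⧸ identities k H A

instance : Ring (Universal k H A) := inferInstanceAs (Ring (TensorAlgebra k H ⧸ identities k H A))

instance : Algebra k (Universal k H A) :=
  inferInstanceAs (Algebra k (TensorAlgebra k H ⧸ identities k H A))

/-- The projection `T(X_H) → U_H(A)`. -/
def Universal.mk : TensorAlgebra k H →ₐ[k] Universal k H A :=
  Ideal.Quotient.mkₐ k (identities k H A)

theorem Universal.mk_surjective : Function.Surjective (Universal.mk k H A) :=
  Ideal.Quotient.mkₐ_surjective k (identities k H A)

/-- `I_H(A)` is a right coideal. -/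
theorem coaction_identities {P : TensorAlgebra k H} (hP : P ∈ identities k H A) :
    (Algebra.TensorProduct.map (Universal.mk k H A) (AlgHom.id k H)).comp
      (coaction k H (TensorAlgebra k H)) P = 0 := by
  obtain ⟨c, hc⟩ := TensorProduct.eq_repr_basis_right (Module.Basis.ofVectorSpace k H)
    (coaction k H (TensorAlgebra k H) P)
  have hmem : ∀ i, c i ∈ identities k H A := by
    refine fun i => mem_identities.2 fun μ hμ => ?_
    have h := hμ P
    rw [mem_identities.1 hP μ hμ, map_zero, ← hc, Finsupp.sum, map_sum] at h
    simp only [LinearMap.rTensor_tmul, AlgHom.toLinearMap_apply] at h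
    have h0 := TensorProduct.sum_tmul_basis_right_eq_zero (Module.Basis.ofVectorSpace k H)
      (c.mapRange μ (map_zero μ)) (by
        rw [Finsupp.sum_mapRange_index (by simp)]
        exact h.symm)
    simpa using DFunLike.congr_fun h0 i
  rw [AlgHom.comp_apply, ← hc, Finsupp.sum, map_sum]
  refine Finset.sum_eq_zero fun i _ => ?_
  have : Universal.mk k H A (c i) = 0 := Ideal.Quotient.eq_zero_iff_mem.2 (hmem i)
  rw [Algebra.TensorProduct.map_tmul, this, TensorProduct.zero_tmul]

/-- The coaction on `U_H(A)` induced by that of `T(X_H)`. -/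
def universalCoaction : Universal k H A →ₐ[k] Universal k H A ⊗[k] H :=
  Ideal.Quotient.liftₐ (identities k H A)
    ((Algebra.TensorProduct.map (Universal.mk k H A) (AlgHom.id k H)).comp
      (coaction k H (TensorAlgebra k H)))
    (fun _ hP => coaction_identities k H A hP)

variable {k H A} in
theorem universalCoaction_mk (P : TensorAlgebra k H) :
    (universalCoaction k H A).toLinearMap ((Universal.mk k H A).toLinearMap P) =
      (Universal.mk k H A).toLinearMap.rTensor H
        ((coaction k H (TensorAlgebra k H)).toLinearMap P) := rfl

instance : ComoduleAlgebra k H (Universal k H A) := by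
  refine { coaction := universalCoaction k H A, coassoc := fun a => ?_, counit := fun a => ?_ }
  · obtain ⟨P, rfl⟩ := Universal.mk_surjective k H A a
    refine coassoc_of_comp (coaction k H (TensorAlgebra k H)).toLinearMap
      (universalCoaction k H A).toLinearMap (Universal.mk k H A).toLinearMap ?_ P ?_
    · exact universalCoaction_mk
    · exact ComoduleAlgebra.coassoc P
  · obtain ⟨P, rfl⟩ := Universal.mk_surjective k H A a
    refine counit_of_comp (coaction k H (TensorAlgebra k H)).toLinearMap
      (universalCoaction k H A).toLinearMap (Universal.mk k H A).toLinearMap ?_ P ?_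
    · exact universalCoaction_mk
    · exact ComoduleAlgebra.counit P

end Identities

/-! ### Two-cocycles and twisted algebras -/

section Twisted

variable {k : Type u} {H : Type v} [Field k] [Ring H] [HopfAlgebra k H]

/-- The bilinear map `(x, y) ↦ α(x₁, y₁) x₂ y₂` attached to a bilinear form `α` on `H`. -/
def twistedMul (α : H ⊗[k] H →ₗ[k] k) : H ⊗[k] H →ₗ[k] H :=
  (TensorProduct.lid k H).toLinearMap ∘ₗ TensorProduct.map α (LinearMap.mul' k H) ∘ₗ
    Coalgebra.comul

variable (k H) in
/-- A normalized convolution-invertible two-cocycle on `H`. The bilinear form `H × H → k` is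
encoded as a linear form on the coalgebra `H ⊗ H`, and invertibility is that in the convolution
algebra `Hom(H ⊗ H, k)`. -/
structure TwoCocycle where
  /-- The bilinear form `α`. -/
  toForm : H ⊗[k] H →ₗ[k] k
  /-- The convolution inverse `α⁻¹`. -/
  invForm : H ⊗[k] H →ₗ[k] k
  mul_inv : WithConv.toConv toForm * WithConv.toConv invForm = 1
  inv_mul : WithConv.toConv invForm * WithConv.toConv toForm = 1
  /-- `α(x₁, y₁) α(x₂ y₂, z) = α(y₁, z₁) α(x, y₂ z₂)` -/
  cocycle : ∀ x y z : H,
    toForm (twistedMul toForm (x ⊗ₜ y) ⊗ₜ z) = toForm (x ⊗ₜ twistedMul toForm (y ⊗ₜ z))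
  apply_one_right : ∀ x : H, toForm (x ⊗ₜ 1) = Coalgebra.counit (R := k) x
  apply_one_left : ∀ x : H, toForm (1 ⊗ₜ x) = Coalgebra.counit (R := k) x

namespace TwoCocycle

variable (α : TwoCocycle k H)

/-- The vector space underlying the twisted algebra: a copy of `H`. -/
def Twisted (_ : TwoCocycle k H) : Type v := H

instance : AddCommGroup α.Twisted := inferInstanceAs (AddCommGroup H)

instance : Module k α.Twisted := inferInstanceAs (Module k H)

/-- The identity map `x ↦ u_x` from `H` to the twisted algebra. -/
def u : H ≃ₗ[k] α.Twisted := LinearEquiv.refl k H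

/-- The product `u_x u_y = α(x₁, y₁) u_{x₂ y₂}`. -/
instance : Mul α.Twisted :=
  ⟨fun a b => α.u (twistedMul α.toForm (α.u.symm a ⊗ₜ α.u.symm b))⟩

theorem u_mul_u (x y : H) : α.u x * α.u y = α.u (twistedMul α.toForm (x ⊗ₜ y)) := rfl

instance : One α.Twisted := ⟨α.u 1⟩

theorem one_def : (1 : α.Twisted) = α.u 1 := rfl

theorem comul_twistedMul (β : H ⊗[k] H →ₗ[k] k) (c : H ⊗[k] H) :
    Coalgebra.comul (R := k) (twistedMul β c) =
      TensorProduct.map (twistedMul β) (LinearMap.mul' k H) (Coalgebra.comul c) := by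
  let L : (H ⊗[k] H) ⊗[k] ((H ⊗[k] H) ⊗[k] (H ⊗[k] H)) →ₗ[k] H ⊗[k] H :=
    (TensorProduct.lid k (H ⊗[k] H)).toLinearMap ∘ₗ
      TensorProduct.map β (TensorProduct.map (LinearMap.mul' k H) (LinearMap.mul' k H))
  have hm : ∀ d : H ⊗[k] H, Coalgebra.comul (R := k) (LinearMap.mul' k H d) =
      TensorProduct.map (LinearMap.mul' k H) (LinearMap.mul' k H) (Coalgebra.comul d) := fun d =>
    (LinearMap.congr_fun (Bialgebra.mulCoalgHom k H).map_comp_comul d).symm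
  have h₁ : ∀ d : (H ⊗[k] H) ⊗[k] (H ⊗[k] H), Coalgebra.comul (R := k)
      (TensorProduct.lid k H (TensorProduct.map β (LinearMap.mul' k H) d)) =
      L ((Coalgebra.comul (R := k)).lTensor (H ⊗[k] H) d) := by
    intro d
    induction d with
    | zero => simp
    | add a b ha hb => simp only [map_add, ha, hb]
    | tmul a b => simp [L, hm]
  have h₂ : ∀ d : (H ⊗[k] H) ⊗[k] (H ⊗[k] H),
      TensorProduct.map (twistedMul β) (LinearMap.mul' k H) d =
      L (TensorProduct.assoc k _ _ _ ((Coalgebra.comul (R := k)).rTensor (H ⊗[k] H) d)) := by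
    intro d
    induction d with
    | zero => simp
    | add a b ha hb => simp only [map_add, ha, hb]
    | tmul a b =>
      simp only [TensorProduct.map_tmul, LinearMap.rTensor_tmul, twistedMul, LinearMap.comp_apply]
      generalize Coalgebra.comul (R := k) a = e
      induction e with
      | zero => simp
      | add a b ha hb => simp only [map_add, TensorProduct.add_tmul, ha, hb]
      | tmul a c => simp [L, TensorProduct.smul_tmul']
  rw [h₂, Coalgebra.coassoc_apply, ← h₁]
  rfl

theorem twistedMul_assoc (x y z : H) :
    twistedMul α.toForm (twistedMul α.toForm (x ⊗ₜ y) ⊗ₜ z) =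
      twistedMul α.toForm (x ⊗ₜ twistedMul α.toForm (y ⊗ₜ z)) := by
  have h : ∀ p q r : H ⊗[k] H,
      TensorProduct.lid k H (TensorProduct.map α.toForm (LinearMap.mul' k H)
        (TensorProduct.AlgebraTensorModule.tensorTensorTensorComm k k k k H H H H
          (TensorProduct.map (twistedMul α.toForm) (LinearMap.mul' k H)
            (TensorProduct.AlgebraTensorModule.tensorTensorTensorComm k k k k H H H H
              (p ⊗ₜ q)) ⊗ₜ r))) =
      TensorProduct.lid k H (TensorProduct.map α.toForm (LinearMap.mul' k H)
        (TensorProduct.AlgebraTensorModule.tensorTensorTensorComm k k k k H H H H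
          (p ⊗ₜ TensorProduct.map (twistedMul α.toForm) (LinearMap.mul' k H)
            (TensorProduct.AlgebraTensorModule.tensorTensorTensorComm k k k k H H H H
              (q ⊗ₜ r))))) := by
    intro p q r
    induction p with
    | zero => simp
    | add a b ha hb => simp only [map_add, TensorProduct.add_tmul, ha, hb]
    | tmul x₁ x₂ =>
      induction q with
      | zero => simp
      | add a b ha hb => simp only [map_add, TensorProduct.add_tmul, TensorProduct.tmul_add, ha, hb]
      | tmul y₁ y₂ =>
        induction r with
        | zero => simp
        | add a b ha hb => simp only [map_add, TensorProduct.tmul_add, ha, hb]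
        | tmul z₁ z₂ =>
          have := α.cocycle x₁ y₁ z₁
          simp only [TensorProduct.AlgebraTensorModule.tensorTensorTensorComm_tmul,
            TensorProduct.map_tmul, TensorProduct.lid_tmul, LinearMap.mul'_apply, mul_assoc]
          exact congrArg (· • (x₂ * (y₂ * z₂))) this
  have e : ∀ a b : H, twistedMul α.toForm (a ⊗ₜ b) =
      TensorProduct.lid k H (TensorProduct.map α.toForm (LinearMap.mul' k H)
        (TensorProduct.AlgebraTensorModule.tensorTensorTensorComm k k k k H H H H
          (Coalgebra.comul a ⊗ₜ Coalgebra.comul b))) := fun _ _ => rfl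
  refine (e _ _).trans (Eq.trans ?_ (e _ _).symm)
  rw [comul_twistedMul, comul_twistedMul,
    TensorProduct.comul_tmul, TensorProduct.comul_tmul]
  exact h _ _ _

theorem twistedMul_one (x : H) : twistedMul α.toForm (x ⊗ₜ 1) = x := by
  have h : ∀ p : H ⊗[k] H,
      TensorProduct.lid k H (TensorProduct.map α.toForm (LinearMap.mul' k H)
        (TensorProduct.AlgebraTensorModule.tensorTensorTensorComm k k k k H H H H
          (p ⊗ₜ (1 ⊗ₜ 1)))) =
      TensorProduct.lid k H ((Coalgebra.counit (R := k)).rTensor H p) := by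
    intro p
    induction p with
    | zero => simp
    | add a b ha hb => simp only [map_add, TensorProduct.add_tmul, ha, hb]
    | tmul a b => simp [α.apply_one_right]
  have e := h (Coalgebra.comul x)
  rw [Coalgebra.rTensor_counit_comul, TensorProduct.lid_tmul, one_smul] at e
  refine Eq.trans ?_ e
  simp [twistedMul, Algebra.TensorProduct.one_def]

theorem one_twistedMul (x : H) : twistedMul α.toForm (1 ⊗ₜ x) = x := by
  have h : ∀ p : H ⊗[k] H,
      TensorProduct.lid k H (TensorProduct.map α.toForm (LinearMap.mul' k H)
        (TensorProduct.AlgebraTensorModule.tensorTensorTensorComm k k k k H H H H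
          ((1 ⊗ₜ 1) ⊗ₜ p))) =
      TensorProduct.lid k H ((Coalgebra.counit (R := k)).rTensor H p) := by
    intro p
    induction p with
    | zero => simp
    | add a b ha hb => simp only [map_add, TensorProduct.tmul_add, ha, hb]
    | tmul a b => simp [α.apply_one_left]
  have e := h (Coalgebra.comul x)
  rw [Coalgebra.rTensor_counit_comul, TensorProduct.lid_tmul, one_smul] at e
  refine Eq.trans ?_ e
  simp [twistedMul, Algebra.TensorProduct.one_def]

instance : Ring α.Twisted where
  __ := (inferInstance : AddCommGroup α.Twisted)
  left_distrib a b c := by simp only [HMul.hMul, Mul.mul, map_add, TensorProduct.tmul_add]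
  right_distrib a b c := by simp only [HMul.hMul, Mul.mul, map_add, TensorProduct.add_tmul]
  zero_mul a := by simp only [HMul.hMul, Mul.mul, map_zero, TensorProduct.zero_tmul]
  mul_zero a := by simp only [HMul.hMul, Mul.mul, map_zero, TensorProduct.tmul_zero]
  mul_assoc a b c := congrArg α.u (α.twistedMul_assoc _ _ _)
  one_mul a := congrArg α.u (α.one_twistedMul _)
  mul_one a := congrArg α.u (α.twistedMul_one _)

instance : Algebra k α.Twisted :=
  Algebra.ofModule
    (fun r a b => by
      change α.u _ = r • α.u _
      rw [← map_smul, ← map_smul, map_smul α.u.symm, TensorProduct.smul_tmul'])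
    (fun r a b => by
      change α.u _ = r • α.u _
      rw [← map_smul, ← map_smul, map_smul α.u.symm, TensorProduct.tmul_smul])

/-- The coaction `u_x ↦ u_{x₁} ⊗ x₂` on the twisted algebra. -/
def twistedCoaction : α.Twisted →ₐ[k] α.Twisted ⊗[k] H :=
  AlgHom.ofLinearMap
    (α.u.toLinearMap.rTensor H ∘ₗ Coalgebra.comul ∘ₗ α.u.symm.toLinearMap)
    (by
      change α.u.toLinearMap.rTensor H (Coalgebra.comul (1 : H)) = 1
      rw [Bialgebra.comul_one]
      rfl)
    (by
      intro a b
      obtain ⟨x, rfl⟩ := α.u.surjective a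
      obtain ⟨y, rfl⟩ := α.u.surjective b
      have h : ∀ p q : H ⊗[k] H, α.u.toLinearMap.rTensor H
          (TensorProduct.map (twistedMul α.toForm) (LinearMap.mul' k H)
            (TensorProduct.AlgebraTensorModule.tensorTensorTensorComm k k k k H H H H
              (p ⊗ₜ q))) = α.u.toLinearMap.rTensor H p * α.u.toLinearMap.rTensor H q := by
        intro p q
        induction p with
        | zero => simp
        | add a b ha hb => simp only [map_add, TensorProduct.add_tmul, add_mul, ha, hb]
        | tmul x₁ x₂ =>
          induction q with
          | zero => simp
          | add a b ha hb => simp only [map_add, TensorProduct.tmul_add, mul_add, ha, hb]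
          | tmul y₁ y₂ => simp [u_mul_u]
      simp only [u_mul_u, LinearMap.comp_apply, LinearEquiv.coe_coe, LinearEquiv.symm_apply_apply,
        comul_twistedMul]
      exact h _ _)

instance : ComoduleAlgebra k H α.Twisted where
  coaction := α.twistedCoaction
  coassoc a := coassoc_of_comp Coalgebra.comul α.twistedCoaction.toLinearMap α.u.toLinearMap
    (fun _ => rfl) (α.u.symm a) (Coalgebra.coassoc_apply _)
  counit a := counit_of_comp Coalgebra.comul α.twistedCoaction.toLinearMap α.u.toLinearMap
    (fun _ => rfl) (α.u.symm a) (Coalgebra.lTensor_counit_comul _)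

/-- `α` is non-degenerate if the center of the twisted algebra is one-dimensional. -/
def Nondegenerate : Prop :=
  Module.finrank k (Subalgebra.center k α.Twisted) = 1

/-- The universal comodule algebra `U_H^α` of the twisted algebra. -/
abbrev U : Type (max u v) := Universal k H α.Twisted

/-- The center `Z_H^α` of `U_H^α`. -/
abbrev Z : Type (max u v) := Center k α.U

/-- The universal comodule algebra map `μ_α : T(X_H) → S(t_H) ⊗ ^αH`, `X_x ↦ t_{x₁} u_{x₂}`. -/
def universalMap : TensorAlgebra k H →ₐ[k] SymmetricAlgebra k H ⊗[k] α.Twisted :=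
  TensorAlgebra.lift k
    (TensorProduct.map (SymmetricAlgebra.ι k H) α.u.toLinearMap ∘ₗ Coalgebra.comul)

/-! ### The generic base algebra -/

variable (k H) in
/-- The field of fractions of `S(t_H)`. -/
abbrev FracS : Type (max u v) := FractionRing (SymmetricAlgebra k H)

variable (k H) in
/-- The linear map `x ↦ t_x` with values in `Frac S(t_H)`. -/
def t : H →ₗ[k] FracS k H :=
  (IsScalarTower.toAlgHom k (SymmetricAlgebra k H) (FracS k H)).toLinearMap ∘ₗ
    SymmetricAlgebra.ι k H

variable (k H) in
/-- The linear map `x ↦ t⁻¹_x` with values in `Frac S(t_H)`: the inverse of `t` in the convolution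
algebra `Hom(H, Frac S(t_H))`, that is `t_{x₁} t⁻¹_{x₂} = t⁻¹_{x₁} t_{x₂} = ε(x) 1`. (The element
`t` is always invertible there, so that `Ring.inverse` never takes its default value.) -/
def tInv : H →ₗ[k] FracS k H :=
  (Ring.inverse (WithConv.toConv (t k H))).ofConv

/-- The form `α`, or any other, with values in `Frac S(t_H)`. -/
def toFrac (β : H ⊗[k] H →ₗ[k] k) : H ⊗[k] H →ₗ[k] FracS k H :=
  Algebra.linearMap k (FracS k H) ∘ₗ β

/-- `σ(x, y) = t_{x₁} t_{y₁} α(x₂, y₂) t⁻¹_{x₃ y₃}`, as a convolution product of three linear maps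
on the coalgebra `H ⊗ H`. -/
def sigma : H ⊗[k] H →ₗ[k] FracS k H :=
  (WithConv.toConv (LinearMap.mul' k (FracS k H) ∘ₗ TensorProduct.map (t k H) (t k H)) *
    WithConv.toConv (toFrac α.toForm) *
    WithConv.toConv (tInv k H ∘ₗ LinearMap.mul' k H)).ofConv

/-- `σ⁻¹(x, y) = t_{x₁ y₁} α⁻¹(x₂, y₂) t⁻¹_{x₃} t⁻¹_{y₃}`. -/
def sigmaInv : H ⊗[k] H →ₗ[k] FracS k H :=
  (WithConv.toConv (t k H ∘ₗ LinearMap.mul' k H) *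
    WithConv.toConv (toFrac α.invForm) *
    WithConv.toConv (LinearMap.mul' k (FracS k H) ∘ₗ
      TensorProduct.map (tInv k H) (tInv k H))).ofConv

/-- The generic base algebra `B_H^α`: the subalgebra of `Frac S(t_H)` generated by the elements
`σ(x, y)` and `σ⁻¹(x, y)`. -/
def B : Subalgebra k (FracS k H) :=
  Algebra.adjoin k
    (Set.range (fun p : H × H => α.sigma (p.1 ⊗ₜ p.2)) ∪
      Set.range (fun p : H × H => α.sigmaInv (p.1 ⊗ₜ p.2)))

end TwoCocycle

end Twisted

/-! ### Localizations and base change from the center -/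

/-- The ring map `f : R → S` makes `S` a localization of `R`. -/
def IsLocalizationMap {R S : Type*} [CommRing R] [CommRing S] (f : R →+* S) : Prop :=
  letI := f.toAlgebra
  ∃ M : Submonoid R, IsLocalization M S

section BaseChange

variable {k Z B : Type*} [Field k] [CommRing Z] [Algebra k Z] [CommRing B] [Algebra k B]

/-- The algebra `B ⊗_Z U`, where `U` is a `Z`-algebra and `B` is a `Z`-algebra by means of
`ι : Z → B`. -/
def BaseChange (ι : Z →ₐ[k] B) (U : Type*) [Ring U] [Algebra Z U] : Type _ :=
  letI := ι.toRingHom.toAlgebra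
  B ⊗[Z] U

variable (ι : Z →ₐ[k] B) (U : Type*) [Ring U] [Algebra Z U]

instance : Ring (BaseChange ι U) :=
  letI := ι.toRingHom.toAlgebra
  (inferInstance : Ring (B ⊗[Z] U))

instance : Algebra B (BaseChange ι U) :=
  letI := ι.toRingHom.toAlgebra
  (inferInstance : Algebra B (B ⊗[Z] U))

instance : Algebra k (BaseChange ι U) :=
  Algebra.compHom _ (algebraMap k B)

instance : IsScalarTower k B (BaseChange ι U) :=
  .of_algebraMap_eq fun _ => rfl

/-- The algebra map `U → B ⊗_Z U`, `x ↦ 1 ⊗ x`. -/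
def BaseChange.ofU [Algebra k U] [IsScalarTower k Z U] : U →ₐ[k] BaseChange ι U :=
  letI := ι.toRingHom.toAlgebra
  { toRingHom := (Algebra.TensorProduct.includeRight : U →ₐ[Z] B ⊗[Z] U).toRingHom
    commutes' := fun r => by
      rw [IsScalarTower.algebraMap_apply k Z U]
      refine ((Algebra.TensorProduct.includeRight : U →ₐ[Z] B ⊗[Z] U).commutes _).trans ?_
      change (ι (algebraMap k Z r)) ⊗ₜ[Z] (1 : U) = (algebraMap k B r) ⊗ₜ[Z] (1 : U)
      rw [AlgHom.commutes] }

end BaseChange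

end HopfIdent

end

open HopfIdent

noncomputable section

namespace HopfIdent

open Coalgebra WithConv

/-! ### Convolution invertibility as bijectivity of a translation -/

section Translate

variable {k A C : Type*} [Field k] [Ring A] [Algebra k A] [AddCommGroup C] [Module k C]

/-! Everything is compared inside `G = Frac S(t_H) ⊗ ^αH`. Comodule algebra maps `T(X_H) → ^αH` are
exactly the specializations of `μ_α` at linear forms on `H`. As `k` is infinite, these separate the
points of `S(t_H) ⊗ ^αH`, so the identities are the kernel of `μ_α` (`mem_identities_iff`) and `U`
embeds in `G`, with `X_x` going to `v_x = t_{x₁} ⊗ u_{x₂}`.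

In `G` one has `v_x v_y = σ(x₁, y₁) v_{x₂y₂}` (`twisted_convMul`), and `f ⊗ x ↦ f v_x` is an
isomorphism `Frac S(t_H) ⊗ H ≅ G` because `t` is convolution-invertible. For the latter, restrict
the translation `f ⊗ x ↦ f t_{x₁} ⊗ x₂` to a finite-dimensional left coideal: its matrix has entries
in `S(t_H)` and becomes the identity when `t` is specialized to `ε`, so its determinant is nonzero.

A central element of `U` commutes with all `v_x`, hence with `G`, and is a scalar by non-degeneracy.
It also lies in the `B`-span of the `v_x`, and a scalar of that span belongs to `B`
(`mem_B_of_mem_baseSpan`). This gives `ι`.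

If `B` is a localization of `Z`, clearing denominators shows that `B ⊗_Z U → G` is injective. Its
image is the `B`-span of the `v_x`, so `B ⊗_Z U` is a crossed product of `B` and `H` with cocycle
`σ`, invertible over `B`. Any such crossed product is cleft and Galois: in coordinates the canonical
map is the translation by `x ↦ v_x`, a composite of the translation by `σ` and the bijection `y ⊗ x
↦ y x₁ ⊗ x₂` of `H ⊗ H` (`translate_gen_bijective`). -/

theorem leftLinear_ext {P : Type*} [AddCommGroup P] [Module A P]
    {f g : A ⊗[k] C →ₗ[A] P} (h : ∀ x : C, f (1 ⊗ₜ x) = g (1 ⊗ₜ x)) : f = g := by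
  ext w
  induction w with
  | zero => simp
  | add a b ha hb => simp only [map_add, ha, hb]
  | tmul a x =>
    have : a ⊗ₜ[k] x = a • ((1 : A) ⊗ₜ[k] x) := by simp [TensorProduct.smul_tmul']
    rw [this, map_smul, map_smul, h]

/-- The left `A`-linear extension `a ⊗ x ↦ a f(x)` of a linear map `f : C → A`. -/
def extend (f : C →ₗ[k] A) : A ⊗[k] C →ₗ[A] A :=
  TensorProduct.AlgebraTensorModule.lift (LinearMap.toSpanSingleton A (C →ₗ[k] A) f)

theorem extend_tmul (f : C →ₗ[k] A) (a : A) (x : C) : extend f (a ⊗ₜ x) = a * f x := rfl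

variable [Coalgebra k C]

/-- The left `A`-linear endomorphism `a ⊗ x ↦ a g(x₁) ⊗ x₂` of `A ⊗ C`. -/
def translate (g : C →ₗ[k] A) : A ⊗[k] C →ₗ[A] A ⊗[k] C :=
  TensorProduct.AlgebraTensorModule.lift
    (LinearMap.toSpanSingleton A (C →ₗ[k] A ⊗[k] C) (g.rTensor C ∘ₗ comul))

theorem translate_tmul (g : C →ₗ[k] A) (a : A) (x : C) :
    translate g (a ⊗ₜ x) = a • g.rTensor C (comul x) := rfl

theorem translate_one_tmul (g : C →ₗ[k] A) (x : C) :
    translate g (1 ⊗ₜ x) = g.rTensor C (comul x) := by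
  rw [translate_tmul, one_smul]

/-- By coassociativity both sides send `1 ⊗ x` to `h(x₁) g(x₂) ⊗ x₃`. The order is reversed because
the later translation multiplies on the right of the coefficient already produced. -/
theorem translate_comp (g h : C →ₗ[k] A) :
    translate g ∘ₗ translate h = translate (toConv h * toConv g).ofConv := by
  refine leftLinear_ext fun x => ?_
  rw [LinearMap.comp_apply, translate_one_tmul, translate_one_tmul]
  let L : C ⊗[k] (C ⊗[k] C) →ₗ[k] A ⊗[k] C :=
    (LinearMap.mul' k A).rTensor C ∘ₗ (TensorProduct.assoc k A A C).symm.toLinearMap ∘ₗ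
      TensorProduct.map h (g.rTensor C)
  have h₁ : ∀ y : C ⊗[k] C, translate g (h.rTensor C y) = L (comul.lTensor C y) := by
    intro y
    induction y with
    | zero => simp
    | add a b ha hb => simp only [map_add, ha, hb]
    | tmul a b =>
      simp only [LinearMap.rTensor_tmul, LinearMap.lTensor_tmul, translate_tmul]
      induction (comul b : C ⊗[k] C) with
      | zero => simp
      | add a b ha hb => simp only [map_add, smul_add, TensorProduct.tmul_add, ha, hb]
      | tmul c d => simp [L, TensorProduct.smul_tmul']
  have h₂ : ∀ y : C ⊗[k] C, (toConv h * toConv g).ofConv.rTensor C y =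
      L (TensorProduct.assoc k C C C (comul.rTensor C y)) := by
    intro y
    induction y with
    | zero => simp
    | add a b ha hb => simp only [map_add, ha, hb]
    | tmul a b =>
      simp only [LinearMap.rTensor_tmul, LinearMap.convMul_def, LinearMap.comp_apply]
      induction (comul a : C ⊗[k] C) with
      | zero => simp
      | add a b ha hb => simp only [map_add, TensorProduct.add_tmul, ha, hb]
      | tmul c d => simp [L]
  rw [h₁, h₂, Coalgebra.coassoc_apply]

theorem translate_one : translate (1 : WithConv (C →ₗ[k] A)).ofConv = LinearMap.id := by
  refine leftLinear_ext fun x => ?_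
  rw [translate_one_tmul, LinearMap.convOne_def, ofConv_toConv, LinearMap.rTensor_comp_apply,
    Coalgebra.rTensor_counit_comul]
  simp

theorem translate_bijective {g : C →ₗ[k] A} (hg : IsUnit (toConv g)) :
    Function.Bijective (translate g) := by
  obtain ⟨⟨_, h, h₁, h₂⟩, rfl⟩ := hg
  refine Function.bijective_iff_has_inverse.2 ⟨translate h.ofConv, fun w => ?_, fun w => ?_⟩
  · have := translate_comp h.ofConv g
    rw [toConv_ofConv, h₁, translate_one] at this
    exact LinearMap.congr_fun this w
  · have := translate_comp g h.ofConv
    rw [toConv_ofConv, h₂, translate_one] at this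
    exact LinearMap.congr_fun this w

theorem convMul_eq_extend (f g : C →ₗ[k] A) (x : C) :
    (toConv g * toConv f) x = extend f (translate g (1 ⊗ₜ x)) := by
  rw [translate_one_tmul, LinearMap.convMul_apply]
  induction (comul x : C ⊗[k] C) with
  | zero => simp
  | add a b ha hb => simp only [map_add, ha, hb]
  | tmul c d => simp [extend_tmul]

/-- Since `g * f` is the extension of `f` composed with the translation by `g`, inverting the
translation solves `g * f = ε` for `f`. This gives inverses without a formula, even for
noncommutative `A`. -/
theorem isUnit_of_translate_bijective {g : C →ₗ[k] A} (hg : Function.Bijective (translate g)) :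
    IsUnit (toConv g) := by
  let e : A ⊗[k] C ≃ₗ[A] A ⊗[k] C := LinearEquiv.ofBijective (translate g) hg
  have inj : ∀ f f' : WithConv (C →ₗ[k] A), toConv g * f = toConv g * f' → f = f' := by
    intro f f' h
    have h' : extend f.ofConv ∘ₗ translate g = extend f'.ofConv ∘ₗ translate g := by
      refine leftLinear_ext fun x => ?_
      have := congrArg (fun φ : WithConv (C →ₗ[k] A) => φ x) h
      have e₁ := convMul_eq_extend f.ofConv g x
      have e₂ := convMul_eq_extend f'.ofConv g x
      rw [toConv_ofConv] at e₁ e₂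
      rw [LinearMap.comp_apply, LinearMap.comp_apply, ← e₁, ← e₂]
      exact this
    ext x
    have := LinearMap.congr_fun h' (e.symm (1 ⊗ₜ x))
    have he : translate g (e.symm (1 ⊗ₜ x)) = 1 ⊗ₜ x := e.apply_symm_apply _
    rw [LinearMap.comp_apply, LinearMap.comp_apply, he, extend_tmul, extend_tmul, one_mul,
      one_mul] at this
    exact this
  let ε : C →ₗ[k] A := Algebra.linearMap k A ∘ₗ counit
  let f : C →ₗ[k] A := ((extend ε).restrictScalars k ∘ₗ (e.symm.restrictScalars k).toLinearMap) ∘ₗ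
    TensorProduct.mk k A C 1
  have hf : extend f = extend ε ∘ₗ e.symm.toLinearMap :=
    leftLinear_ext fun x => by rw [extend_tmul, one_mul]; rfl
  have h₁ : toConv g * toConv f = 1 := by
    ext x
    rw [convMul_eq_extend, hf]
    have : e.symm (translate g (1 ⊗ₜ x)) = 1 ⊗ₜ x := e.symm_apply_apply _
    simp only [LinearMap.comp_apply, LinearEquiv.coe_coe, this]
    rw [extend_tmul, one_mul]
    rfl
  -- A right inverse is two-sided because `g` can be cancelled on the left: `g * (f * g) = g = g *
  -- 1`.
  have h₂ : toConv f * toConv g = 1 := inj _ _ (by rw [← mul_assoc, h₁, one_mul, mul_one])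
  exact ⟨⟨_, _, h₁, h₂⟩, rfl⟩

end Translate

/-! ### Local finiteness: finite-dimensional left coideals -/

section LeftCoideal

variable {k C : Type*} [Field k] [AddCommGroup C] [Module k C]

/-- The linear form `f ⊗ id` on the first tensor factor. -/
def contractLeft (D : Type*) [AddCommGroup D] [Module k D] (f : C →ₗ[k] k) : C ⊗[k] D →ₗ[k] D :=
  (TensorProduct.lid k D).toLinearMap ∘ₗ f.rTensor D

theorem contractLeft_tmul {D : Type*} [AddCommGroup D] [Module k D] (f : C →ₗ[k] k) (x : C)
    (y : D) : contractLeft D f (x ⊗ₜ y) = f x • y := by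
  simp [contractLeft]

theorem exists_finite_contractLeft {D : Type*} [AddCommGroup D] [Module k D] (w : C ⊗[k] D) :
    ∃ V : Submodule k D, FiniteDimensional k V ∧ ∀ f : C →ₗ[k] k, contractLeft D f w ∈ V := by
  induction w with
  | zero => exact ⟨⊥, inferInstance, fun f => by simp⟩
  | add a b ha hb =>
    obtain ⟨V, hV, h⟩ := ha
    obtain ⟨V', hV', h'⟩ := hb
    refine ⟨V ⊔ V', inferInstance, fun f => ?_⟩
    rw [map_add]
    exact Submodule.add_mem_sup (h f) (h' f)
  | tmul x y =>
    refine ⟨k ∙ y, inferInstance, fun f => ?_⟩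
    rw [contractLeft_tmul]
    exact Submodule.smul_mem _ _ (Submodule.mem_span_singleton_self y)

theorem eq_sum_contractLeft {D ι : Type*} [AddCommGroup D] [Module k D] (b : Module.Basis ι k C)
    (w : C ⊗[k] D) : ∃ s : Finset ι, w = ∑ i ∈ s, b i ⊗ₜ contractLeft D (b.coord i) w := by
  obtain ⟨c, rfl⟩ := TensorProduct.eq_repr_basis_left b w
  refine ⟨c.support, ?_⟩
  rw [Finsupp.sum]
  refine Finset.sum_congr rfl fun i hi => ?_
  congr 1
  rw [map_sum, Finset.sum_eq_single i]
  · simp [contractLeft_tmul]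
  · intro j _ hj
    simp [contractLeft_tmul, hj]
  · intro h
    exact absurd hi h

/-- Contractions with the coordinate forms of a basis of `C` are the coefficients of `w` along that
basis. -/
theorem mem_range_lTensor {D : Type*} [AddCommGroup D] [Module k D] (V : Submodule k D)
    (w : C ⊗[k] D) (h : ∀ f : C →ₗ[k] k, contractLeft D f w ∈ V) :
    w ∈ LinearMap.range (V.subtype.lTensor C) := by
  obtain ⟨s, hs⟩ := eq_sum_contractLeft (Module.Basis.ofVectorSpace k C) w
  rw [hs]
  refine Submodule.sum_mem _ fun i _ => ⟨_ ⊗ₜ ⟨_, h _⟩, LinearMap.lTensor_tmul _ _ _ _⟩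

variable [Coalgebra k C]

/-- By coassociativity, `x ↦ f(x₁) x₂` is a right action of the convolution algebra `C*` on `C`. -/
theorem contractLeft_comul (f g : C →ₗ[k] k) (x : C) :
    contractLeft C g (comul (contractLeft C f (comul x))) =
      contractLeft C (toConv f * toConv g).ofConv (comul x) := by
  let L : C ⊗[k] (C ⊗[k] C) →ₗ[k] C := contractLeft C g ∘ₗ contractLeft (C ⊗[k] C) f
  have h₁ : ∀ y : C ⊗[k] C, contractLeft C g (comul (contractLeft C f y)) =
      L (comul.lTensor C y) := by
    intro y
    induction y with
    | zero => simp
    | add a b ha hb => simp only [map_add, ha, hb]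
    | tmul a b => simp [L, contractLeft_tmul]
  have h₂ : ∀ y : C ⊗[k] C, contractLeft C (toConv f * toConv g).ofConv y =
      L (TensorProduct.assoc k C C C (comul.rTensor C y)) := by
    intro y
    induction y with
    | zero => simp
    | add a b ha hb => simp only [map_add, ha, hb]
    | tmul a b =>
      simp only [LinearMap.rTensor_tmul, LinearMap.convMul_def, contractLeft_tmul,
        LinearMap.comp_apply]
      induction (comul a : C ⊗[k] C) with
      | zero => simp
      | add a b ha hb => simp only [map_add, TensorProduct.add_tmul, add_smul, ha, hb]
      | tmul c d => simp [L, contractLeft_tmul, mul_smul]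
  rw [h₁, h₂, Coalgebra.coassoc_apply]

/-- A subspace `V` with `Δ(V) ⊆ C ⊗ V`. -/
def IsLeftCoideal (V : Submodule k C) : Prop :=
  ∀ x ∈ V, ∀ f : C →ₗ[k] k, contractLeft C f (comul x) ∈ V

theorem IsLeftCoideal.sup {V W : Submodule k C} (hV : IsLeftCoideal V) (hW : IsLeftCoideal W) :
    IsLeftCoideal (V ⊔ W) := by
  intro x hx f
  obtain ⟨y, hy, z, hz, rfl⟩ := Submodule.mem_sup.1 hx
  rw [map_add, map_add]
  exact Submodule.add_mem_sup (hV y hy f) (hW z hz f)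

/-- Take the orbit of `x` under the action of `C*`: it is finite-dimensional because `Δ(x)` is a
finite sum of pure tensors, stable because this is an action, and contains `x` by the counit axiom.
-/
theorem exists_finite_leftCoideal (x : C) :
    ∃ V : Submodule k C, FiniteDimensional k V ∧ IsLeftCoideal V ∧ x ∈ V := by
  let V : Submodule k C :=
    Submodule.span k (Set.range fun f : C →ₗ[k] k => contractLeft C f (comul x))
  obtain ⟨W, hW, h⟩ := exists_finite_contractLeft (comul (R := k) x)
  have hVW : V ≤ W := Submodule.span_le.2 (by rintro _ ⟨f, rfl⟩; exact h f)
  refine ⟨V, Submodule.finiteDimensional_of_le hVW, ?_, ?_⟩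
  · intro y hy g
    induction hy using Submodule.span_induction with
    | mem y hy =>
      obtain ⟨f, rfl⟩ := hy
      rw [contractLeft_comul]
      exact Submodule.subset_span ⟨_, rfl⟩
    | zero => simp
    | add a b _ _ ha hb => rw [map_add, map_add]; exact V.add_mem ha hb
    | smul r a _ ha => rw [map_smul, map_smul]; exact V.smul_mem r ha
  · refine Submodule.subset_span ⟨counit (R := k), ?_⟩
    simp [contractLeft]

theorem exists_leftCoideal_mem_range {A : Type*} [AddCommGroup A] [Module k A] (w : A ⊗[k] C) :
    ∃ V : Submodule k C, FiniteDimensional k V ∧ IsLeftCoideal V ∧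
      w ∈ LinearMap.range (V.subtype.lTensor A) := by
  induction w with
  | zero => exact ⟨⊥, inferInstance, fun x hx f => by simp [(Submodule.mem_bot k).1 hx], zero_mem _⟩
  | add a b ha hb =>
    obtain ⟨V, _, hV, ⟨v, rfl⟩⟩ := ha
    obtain ⟨W, _, hW, ⟨w, rfl⟩⟩ := hb
    refine ⟨V ⊔ W, inferInstance, hV.sup hW, ?_⟩
    refine Submodule.add_mem _
      ⟨(Submodule.inclusion le_sup_left).lTensor A v, ?_⟩
      ⟨(Submodule.inclusion le_sup_right).lTensor A w, ?_⟩
    all_goals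
      rw [← LinearMap.lTensor_comp_apply]
      rfl
  | tmul a x =>
    obtain ⟨V, hV, h, hx⟩ := exists_finite_leftCoideal (k := k) x
    exact ⟨V, hV, h, ⟨a ⊗ₜ ⟨x, hx⟩, LinearMap.lTensor_tmul _ _ _ _⟩⟩

/-- Matrix coefficients of a finite-dimensional left coideal. -/
theorem IsLeftCoideal.exists_matrix {V : Submodule k C} (hV : IsLeftCoideal V) {ι : Type*}
    [Fintype ι] [DecidableEq ι] (b : Module.Basis ι k V) :
    ∃ c : Matrix ι ι C, (∀ j, comul (R := k) (b j : C) = ∑ i, c i j ⊗ₜ (b i : C)) ∧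
      ∀ i j, counit (R := k) (c i j) = if i = j then 1 else 0 := by
  have : ∀ j, ∃ c : ι → C, comul (R := k) (b j : C) = ∑ i, c i ⊗ₜ (b i : C) := by
    intro j
    obtain ⟨w, hw⟩ := mem_range_lTensor V _ (hV _ (b j).2)
    obtain ⟨c, rfl⟩ := TensorProduct.eq_repr_basis_right b w
    refine ⟨c, ?_⟩
    rw [← hw, Finsupp.sum_fintype _ _ (by simp), map_sum]
    rfl
  choose c hc using this
  refine ⟨fun i j => c j i, hc, fun i j => ?_⟩
  have h := Coalgebra.rTensor_counit_comul (R := k) (b j : C)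
  rw [hc, map_sum] at h
  replace h := congrArg (TensorProduct.lid k C) h
  simp only [map_sum, LinearMap.rTensor_tmul, TensorProduct.lid_tmul, one_smul] at h
  have h' : ∑ i, counit (R := k) (c j i) • b i = b j := by
    apply Subtype.ext
    simpa using h
  have := congrArg (fun y => b.repr y i) h'
  simpa [Finsupp.single_apply, eq_comm] using this

end LeftCoideal

/-! ### Invertibility of the generic map -/

section Invertible

variable {k C : Type*} [Field k] [AddCommGroup C] [Module k C] [Coalgebra k C]

/-- The generic linear map from a coalgebra to a field containing its symmetric algebra is
convolution-invertible. -/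
theorem isUnit_toConv_generic (K : Type*) [Field K] [Algebra k K] [Algebra (SymmetricAlgebra k C) K]
    [IsScalarTower k (SymmetricAlgebra k C) K] [FaithfulSMul (SymmetricAlgebra k C) K] :
    IsUnit (toConv ((IsScalarTower.toAlgHom k (SymmetricAlgebra k C) K).toLinearMap ∘ₗ
      SymmetricAlgebra.ι k C)) := by
  set t := (IsScalarTower.toAlgHom k (SymmetricAlgebra k C) K).toLinearMap ∘ₗ
      SymmetricAlgebra.ι k C with ht
  apply isUnit_of_translate_bijective
  -- The translation preserves `K ⊗ V` for each left coideal `V`, and acts there by an invertible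
  -- matrix. Since every element of `K ⊗ C` lies in some such `K ⊗ V`, bijectivity follows.
  have key : ∀ V : Submodule k C, FiniteDimensional k V → IsLeftCoideal V →
      ∃ (n : ℕ) (b : Module.Basis (Fin n) k V) (M : Matrix (Fin n) (Fin n) K), IsUnit M ∧
        ∀ g : Fin n → K, translate t (∑ j, g j ⊗ₜ (b j : C)) =
          ∑ i, (M.mulVec g) i ⊗ₜ (b i : C) := by
    intro V _ hV
    let b := Module.finBasis k V
    obtain ⟨c, hc, hε⟩ := hV.exists_matrix b
    let T : Matrix (Fin (Module.finrank k V)) (Fin (Module.finrank k V)) (SymmetricAlgebra k C) :=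
      c.map (SymmetricAlgebra.ι k C)
    -- The algebra map `S(C) → k` extending the counit turns the matrix `T` into the identity, so it
    -- sends the determinant to `1`.
    have hT : T.det ≠ 0 := by
      intro h0
      have h1 := AlgHom.map_det (SymmetricAlgebra.lift (counit (R := k) (A := C))) T
      have h2 : (SymmetricAlgebra.lift (counit (R := k) (A := C))).mapMatrix T = 1 := by
        ext i j
        simp [T, hε, Matrix.one_apply]
      rw [h0, h2, map_zero, Matrix.det_one] at h1
      exact zero_ne_one h1
    refine ⟨_, b, T.map (algebraMap (SymmetricAlgebra k C) K), ?_, fun g => ?_⟩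
    · rw [Matrix.isUnit_iff_isUnit_det, isUnit_iff_ne_zero]
      have := RingHom.map_det (algebraMap (SymmetricAlgebra k C) K) T
      rw [RingHom.mapMatrix_apply] at this
      rw [← this]
      exact fun h => hT (FaithfulSMul.algebraMap_injective _ K (by rw [h, map_zero]))
    · rw [map_sum]
      simp only [translate_tmul, hc, map_sum, LinearMap.rTensor_tmul, Finset.smul_sum]
      rw [Finset.sum_comm]
      refine Finset.sum_congr rfl fun i _ => ?_
      rw [Matrix.mulVec, dotProduct, TensorProduct.sum_tmul]
      refine Finset.sum_congr rfl fun j _ => ?_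
      rw [TensorProduct.smul_tmul', smul_eq_mul, mul_comm]
      rfl
  have repr : ∀ (V : Submodule k C) (n : ℕ) (b : Module.Basis (Fin n) k V)
      (w : K ⊗[k] C), w ∈ LinearMap.range (V.subtype.lTensor K) →
      ∃ g : Fin n → K, w = ∑ j, g j ⊗ₜ (b j : C) := by
    rintro V n b _ ⟨w, rfl⟩
    obtain ⟨c, rfl⟩ := TensorProduct.eq_repr_basis_right b w
    refine ⟨c, ?_⟩
    rw [Finsupp.sum_fintype _ _ (by simp), map_sum]
    rfl
  constructor
  · rw [injective_iff_map_eq_zero]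
    intro w hw
    obtain ⟨V, hfin, hV, hwV⟩ := exists_leftCoideal_mem_range w
    obtain ⟨n, b, M, hM, h⟩ := key V hfin hV
    obtain ⟨g, rfl⟩ := repr V n b w hwV
    rw [h] at hw
    have h0 : M.mulVec g = 0 := by
      have inj : Function.Injective (V.subtype.lTensor K) :=
        Module.Flat.lTensor_preserves_injective_linearMap _ V.injective_subtype
      have hw' : ∑ i, (M.mulVec g) i ⊗ₜ[k] b i = 0 := by
        apply inj
        rw [map_sum, map_zero]
        exact hw
      have := TensorProduct.sum_tmul_basis_right_eq_zero b (Finsupp.equivFunOnFinite.symm (M.mulVec g))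
        (by rw [Finsupp.sum_fintype _ _ (by simp)]; exact hw')
      ext i
      exact DFunLike.congr_fun this i
    have hg : g = 0 := by
      have := Matrix.mulVec_injective_of_isUnit hM
      exact this (h0.trans (Matrix.mulVec_zero M).symm)
    simp [hg]
  · intro w
    obtain ⟨V, hfin, hV, hwV⟩ := exists_leftCoideal_mem_range w
    obtain ⟨n, b, M, hM, h⟩ := key V hfin hV
    obtain ⟨g, rfl⟩ := repr V n b w hwV
    obtain ⟨g', rfl⟩ := Matrix.mulVec_surjective_iff_isUnit.2 hM g
    exact ⟨_, h g'⟩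

end Invertible

/-! ### Crossed products are cleft Galois extensions -/

section Crossed

variable (k H R E : Type*) [Field k] [Ring H] [HopfAlgebra k H] [CommRing R] [Algebra k R]
  [Ring E] [Algebra R E]

/-- `E` is a crossed product of `R` and `H`: it is freely spanned over `R` by elements `v_x`,
`x ∈ H`, with `v_x v_y = σ(x₁, y₁) v_{x₂ y₂}` for a convolution-invertible `σ`, and `v_1` is an
invertible scalar. -/
structure CrossedProduct where
  /-- The isomorphism `r ⊗ x ↦ r v_x`. -/
  equiv : R ⊗[k] H ≃ₗ[R] E
  /-- The cocycle. -/
  cocycle : H ⊗[k] H →ₗ[k] R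
  isUnit_cocycle : IsUnit (toConv cocycle)
  mul : ∀ x y : H, equiv (1 ⊗ₜ x) * equiv (1 ⊗ₜ y) =
    equiv ((LinearMap.mul' k H).lTensor R (translate cocycle (1 ⊗ₜ (x ⊗ₜ y))))
  /-- The scalar `v_1⁻¹`. -/
  unit : R
  isUnit_unit : IsUnit unit
  one : equiv (unit ⊗ₜ 1) = 1

namespace CrossedProduct

variable {k H R E} (d : CrossedProduct k H R E)

theorem comul_mul' (c : H ⊗[k] H) : comul (R := k) (LinearMap.mul' k H c) =
    TensorProduct.map (LinearMap.mul' k H) (LinearMap.mul' k H) (comul c) :=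
  (LinearMap.congr_fun (Bialgebra.mulCoalgHom k H).map_comp_comul c).symm

theorem equiv_tmul (a : R) (x : H) : d.equiv (a ⊗ₜ x) = a • d.equiv (1 ⊗ₜ x) := by
  rw [← map_smul, TensorProduct.smul_tmul', smul_eq_mul, mul_one]

theorem lTensor_smul {M N : Type*} [AddCommGroup M] [Module k M] [AddCommGroup N] [Module k N]
    (f : M →ₗ[k] N) (a : R) (w : R ⊗[k] M) : f.lTensor R (a • w) = a • f.lTensor R w := by
  induction w with
  | zero => simp
  | add p q hp hq => simp only [map_add, smul_add, hp, hq]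
  | tmul b x => simp [TensorProduct.smul_tmul']

theorem equiv_mul_equiv (a b : R) (x y : H) : d.equiv (a ⊗ₜ x) * d.equiv (b ⊗ₜ y) =
    d.equiv ((LinearMap.mul' k H).lTensor R (translate d.cocycle ((a * b) ⊗ₜ (x ⊗ₜ y)))) := by
  have h : (a * b) ⊗ₜ[k] (x ⊗ₜ[k] y) = (a * b) • ((1 : R) ⊗ₜ[k] (x ⊗ₜ[k] y)) := by
    rw [TensorProduct.smul_tmul', smul_eq_mul, mul_one]
  rw [h, map_smul, lTensor_smul, map_smul, ← d.mul, d.equiv_tmul a, d.equiv_tmul b,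
    smul_mul_smul_comm]

theorem algebraMap_eq (r : R) : algebraMap R E r = d.equiv ((r * d.unit) ⊗ₜ 1) := by
  rw [Algebra.algebraMap_eq_smul_one, ← d.one, ← map_smul, TensorProduct.smul_tmul', smul_eq_mul]

/-- The map `r v_x ↦ ε(x) r`, in coordinates. -/
def counitAux : R ⊗[k] H →ₗ[k] R :=
  (TensorProduct.rid k R).toLinearMap ∘ₗ (counit (R := k) (A := H)).lTensor R

theorem counitAux_tmul (r : R) (x : H) :
    counitAux (r ⊗ₜ[k] x) = counit (R := k) x • r := by
  simp [counitAux]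

theorem exists_algebraMap_eq (r : R) : ∃ s : R, algebraMap R E s = d.equiv (r ⊗ₜ 1) := by
  obtain ⟨c, hc⟩ := d.isUnit_unit.exists_left_inv
  exact ⟨r * c, by rw [d.algebraMap_eq, mul_assoc, hc, mul_one]⟩

/-- The scalar `r` has coordinate `r v_1⁻¹ ⊗ 1`, from which the counit recovers `r v_1⁻¹`, and
`v_1⁻¹` is a unit. -/
theorem algebraMap_injective (d : CrossedProduct k H R E) : Function.Injective (algebraMap R E) := by
  intro r s h
  rw [d.algebraMap_eq, d.algebraMap_eq] at h
  have := congrArg counitAux (d.equiv.injective h)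
  rw [counitAux_tmul, counitAux_tmul, Bialgebra.counit_one, one_smul, one_smul] at this
  exact d.isUnit_unit.mul_right_cancel this

variable [Algebra k E] [IsScalarTower k R E]

/-- The coaction `r v_x ↦ r v_{x₁} ⊗ x₂`, in coordinates. -/
def coactionAux : R ⊗[k] H →ₗ[k] E ⊗[k] H :=
  (d.equiv.restrictScalars k).toLinearMap.rTensor H ∘ₗ
    (TensorProduct.assoc k R H H).symm.toLinearMap ∘ₗ (comul (R := k) (A := H)).lTensor R

theorem coactionAux_tmul (a : R) (x : H) : d.coactionAux (a ⊗ₜ x) =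
    ((d.equiv.restrictScalars k).toLinearMap ∘ₗ TensorProduct.mk k R H a).rTensor H (comul x) := by
  simp only [coactionAux, LinearMap.comp_apply, LinearMap.lTensor_tmul]
  induction (comul x : H ⊗[k] H) with
  | zero => simp
  | add p q hp hq => simp only [TensorProduct.tmul_add, map_add, hp, hq]
  | tmul y z => simp

/-- Multiplicativity of the coaction: both sides equal `ab σ(x₁, y₁) v_{x₂y₂} ⊗ x₃y₃`. They are the
same map `L` applied to the two iterated coproducts of `x ⊗ y` in `H ⊗ H`; the left one uses that
the product of `H` is a coalgebra map. -/
theorem coactionAux_mul (a b : R) (x y : H) :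
    d.coactionAux ((LinearMap.mul' k H).lTensor R
      (translate d.cocycle ((a * b) ⊗ₜ (x ⊗ₜ y)))) =
      d.coactionAux (a ⊗ₜ x) * d.coactionAux (b ⊗ₜ y) := by
  let e' := (d.equiv.restrictScalars k).toLinearMap
  let L : (H ⊗[k] H) ⊗[k] ((H ⊗[k] H) ⊗[k] (H ⊗[k] H)) →ₗ[k] E ⊗[k] H :=
    e'.rTensor H ∘ₗ (TensorProduct.assoc k R H H).symm.toLinearMap ∘ₗ
      TensorProduct.map ((a * b) • d.cocycle)
        (TensorProduct.map (LinearMap.mul' k H) (LinearMap.mul' k H))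
  have h₁ : ∀ c : (H ⊗[k] H) ⊗[k] (H ⊗[k] H), d.coactionAux ((LinearMap.mul' k H).lTensor R
      ((a * b) • d.cocycle.rTensor (H ⊗[k] H) c)) =
      L ((comul (R := k)).lTensor (H ⊗[k] H) c) := by
    intro c
    induction c with
    | zero => simp
    | add p q hp hq => simp only [map_add, smul_add, hp, hq]
    | tmul p q =>
      simp [L, coactionAux, TensorProduct.smul_tmul', comul_mul', e']
  have h₂ : ∀ p q : H ⊗[k] H, (e' ∘ₗ TensorProduct.mk k R H a).rTensor H p *
      (e' ∘ₗ TensorProduct.mk k R H b).rTensor H q =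
      L (TensorProduct.assoc k _ _ _ ((comul (R := k)).rTensor (H ⊗[k] H)
        (TensorProduct.AlgebraTensorModule.tensorTensorTensorComm k k k k H H H H (p ⊗ₜ q)))) := by
    intro p q
    induction p with
    | zero => simp
    | add p p' hp hp' => simp only [map_add, add_mul, TensorProduct.add_tmul, hp, hp']
    | tmul x₁ x₂ =>
      induction q with
      | zero => simp
      | add q q' hq hq' => simp only [map_add, mul_add, TensorProduct.tmul_add, hq, hq']
      | tmul y₁ y₂ =>
        simp only [LinearMap.rTensor_tmul, LinearMap.comp_apply, TensorProduct.mk_apply,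
          Algebra.TensorProduct.tmul_mul_tmul,
          TensorProduct.AlgebraTensorModule.tensorTensorTensorComm_tmul]
        have := d.equiv_mul_equiv a b x₁ y₁
        change (d.equiv _ * d.equiv _) ⊗ₜ _ = _
        rw [this, translate_tmul]
        generalize (comul (x₁ ⊗ₜ[k] y₁) : (H ⊗[k] H) ⊗[k] (H ⊗[k] H)) = c
        induction c with
        | zero => simp
        | add p q hp hq => simp only [map_add, smul_add, TensorProduct.add_tmul, hp, hq]
        | tmul p q => simp [L, TensorProduct.smul_tmul', e']
  rw [translate_tmul, h₁, ← Coalgebra.coassoc_apply, coactionAux_tmul, coactionAux_tmul, h₂]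
  rfl

/-- The coaction `r v_x ↦ r v_{x₁} ⊗ x₂`. -/
def coactionHom : E →ₐ[k] E ⊗[k] H :=
  AlgHom.ofLinearMap (d.coactionAux ∘ₗ (d.equiv.restrictScalars k).symm.toLinearMap)
    (by
      have h : (d.equiv.restrictScalars k).symm 1 = d.unit ⊗ₜ 1 :=
        (LinearEquiv.symm_apply_eq _).2 d.one.symm
      have h' := d.one
      simp only [LinearMap.comp_apply, LinearEquiv.coe_coe, h, coactionAux_tmul,
        Bialgebra.comul_one, Algebra.TensorProduct.one_def, LinearMap.rTensor_tmul,
        TensorProduct.mk_apply, LinearEquiv.restrictScalars_apply, h'])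
    (by
      intro a b
      obtain ⟨p, rfl⟩ := d.equiv.surjective a
      obtain ⟨q, rfl⟩ := d.equiv.surjective b
      have h : ∀ w, (d.equiv.restrictScalars k).symm (d.equiv w) = w := d.equiv.symm_apply_apply
      induction p with
      | zero => simp
      | add p p' hp hp' => simp only [map_add, add_mul, hp, hp']
      | tmul r x =>
        induction q with
        | zero => simp
        | add q q' hq hq' => simp only [map_add, mul_add, hq, hq']
        | tmul s y =>
          rw [equiv_mul_equiv]
          simp only [LinearMap.comp_apply, LinearEquiv.coe_coe, h]
          exact d.coactionAux_mul r s x y)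

theorem coactionHom_equiv (w : R ⊗[k] H) : d.coactionHom (d.equiv w) = d.coactionAux w :=
  congrArg d.coactionAux (d.equiv.symm_apply_apply w)

/-- A crossed product is a comodule algebra. -/
abbrev comoduleAlgebra : ComoduleAlgebra k H E where
  coaction := d.coactionHom
  coassoc a := by
    obtain ⟨w, rfl⟩ := d.equiv.surjective a
    induction w with
    | zero => simp
    | add p q hp hq => simp only [map_add, hp, hq]
    | tmul r x =>
      refine coassoc_of_comp comul d.coactionHom.toLinearMap
        ((d.equiv.restrictScalars k).toLinearMap ∘ₗ TensorProduct.mk k R H r) ?_ x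
        (Coalgebra.coassoc_apply x)
      intro y
      exact (d.coactionHom_equiv _).trans (d.coactionAux_tmul r y)
  counit a := by
    obtain ⟨w, rfl⟩ := d.equiv.surjective a
    induction w with
    | zero => simp
    | add p q hp hq => simp only [map_add, hp, hq, TensorProduct.add_tmul]
    | tmul r x =>
      refine counit_of_comp comul d.coactionHom.toLinearMap
        ((d.equiv.restrictScalars k).toLinearMap ∘ₗ TensorProduct.mk k R H r) ?_ x
        (Coalgebra.lTensor_counit_comul x)
      intro y
      exact (d.coactionHom_equiv _).trans (d.coactionAux_tmul r y)

/-- The map `x ↦ v_x`. -/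
def gen : H →ₗ[k] E := (d.equiv.restrictScalars k).toLinearMap ∘ₗ TensorProduct.mk k R H 1

theorem gen_apply (x : H) : d.gen x = d.equiv (1 ⊗ₜ x) := rfl

theorem coactionHom_gen (x : H) : d.coactionHom (d.gen x) = d.gen.rTensor H (comul x) :=
  (d.coactionHom_equiv _).trans (d.coactionAux_tmul 1 x)

theorem coactionHom_algebraMap (r : R) :
    d.coactionHom (algebraMap R E r) = algebraMap R E r ⊗ₜ 1 := by
  rw [d.algebraMap_eq, coactionHom_equiv, coactionAux_tmul, Bialgebra.comul_one,
    Algebra.TensorProduct.one_def, LinearMap.rTensor_tmul]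
  rfl

/-- One has `a v_y v_{x₁} ⊗ x₂ = a σ(y₁, x₁) v_{y₂x₂} ⊗ x₃`. So in coordinates the map is the
translation `s` by `σ` on `R ⊗ (H ⊗ H)`, followed by `c₀ : y ⊗ x ↦ y x₁ ⊗ x₂`. The first is
bijective as `σ` is invertible, the second as the identity of `H` has the antipode for convolution
inverse. -/
theorem translate_gen_bijective : Function.Bijective (translate d.gen) := by
  have hid : IsUnit (toConv (LinearMap.id : H →ₗ[k] H)) :=
    ⟨⟨_, _, LinearMap.id_mul_antipode, LinearMap.antipode_mul_id⟩, rfl⟩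
  let c₀ : H ⊗[k] H ≃ₗ[k] H ⊗[k] H :=
    (LinearEquiv.ofBijective _ (translate_bijective hid)).restrictScalars k
  let s : R ⊗[k] (H ⊗[k] H) ≃ₗ[k] R ⊗[k] (H ⊗[k] H) :=
    (LinearEquiv.ofBijective _ (translate_bijective d.isUnit_cocycle)).restrictScalars k
  let e' : (R ⊗[k] H) ⊗[k] H ≃ₗ[k] E ⊗[k] H := (d.equiv.restrictScalars k).rTensor H
  let f : E ⊗[k] H ≃ₗ[k] E ⊗[k] H :=
    e'.symm ≪≫ₗ TensorProduct.assoc k R H H ≪≫ₗ s ≪≫ₗ c₀.lTensor R ≪≫ₗ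
      (TensorProduct.assoc k R H H).symm ≪≫ₗ e'
  suffices h : ∀ w, translate d.gen (e' w) = f (e' w) by
    have : ⇑(translate d.gen) = f := by
      funext w
      obtain ⟨w, rfl⟩ := e'.surjective w
      exact h w
    rw [this]
    exact f.bijective
  intro w
  have hf : f (e' w) = e' ((TensorProduct.assoc k R H H).symm
      (c₀.lTensor R (s (TensorProduct.assoc k R H H w)))) := by
    simp [f]
  rw [hf]
  induction w with
  | zero => simp
  | add p q hp hq =>
    simp only [map_add] at hp hq ⊢
    rw [hp (by simp [f]), hq (by simp [f])]
  | tmul w x =>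
    clear hf
    induction w with
    | zero => simp
    | add p q hp hq => simp only [map_add, TensorProduct.add_tmul, hp, hq]
    | tmul a y =>
      let L : (H ⊗[k] H) ⊗[k] (H ⊗[k] (H ⊗[k] H)) →ₗ[k] E ⊗[k] H :=
        e'.toLinearMap ∘ₗ (TensorProduct.assoc k R H H).symm.toLinearMap ∘ₗ
          TensorProduct.map (a • d.cocycle)
            ((LinearMap.mul' k H).rTensor H ∘ₗ (TensorProduct.assoc k H H H).symm.toLinearMap) ∘ₗ
          (TensorProduct.AlgebraTensorModule.tensorTensorTensorComm k k k k
            H H H (H ⊗[k] H)).toLinearMap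
      have h₁ : ∀ q : H ⊗[k] H, d.equiv (a ⊗ₜ y) • d.gen.rTensor H q =
          L (comul y ⊗ₜ TensorProduct.assoc k H H H ((comul (R := k)).rTensor H q)) := by
        intro q
        induction q with
        | zero => simp
        | add p q hp hq => simp only [map_add, smul_add, TensorProduct.tmul_add, hp, hq]
        | tmul b z =>
          rw [LinearMap.rTensor_tmul, TensorProduct.smul_tmul', smul_eq_mul, gen_apply,
            equiv_mul_equiv, translate_tmul, LinearMap.rTensor_tmul, mul_one,
            TensorProduct.comul_tmul]
          generalize (comul y : H ⊗[k] H) = p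
          generalize (comul b : H ⊗[k] H) = q
          induction p with
          | zero => simp
          | add p p' hp hp' =>
            simp only [map_add, smul_add, TensorProduct.add_tmul, hp, hp']
          | tmul y₁ y₂ =>
            induction q with
            | zero => simp
            | add q q' hq hq' =>
              simp only [map_add, smul_add, TensorProduct.tmul_add, TensorProduct.add_tmul, hq, hq']
            | tmul b₁ b₂ => simp [L, e', TensorProduct.smul_tmul']
      have h₂ : ∀ p q : H ⊗[k] H, e' ((TensorProduct.assoc k R H H).symm
          (c₀.lTensor R (a • d.cocycle.rTensor (H ⊗[k] H)
            (TensorProduct.AlgebraTensorModule.tensorTensorTensorComm k k k k H H H H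
              (p ⊗ₜ q))))) = L (p ⊗ₜ (comul (R := k)).lTensor H q) := by
        intro p q
        induction p with
        | zero => simp
        | add p p' hp hp' => simp only [map_add, smul_add, TensorProduct.add_tmul, hp, hp']
        | tmul y₁ y₂ =>
          induction q with
          | zero => simp
          | add q q' hq hq' => simp only [map_add, smul_add, TensorProduct.tmul_add, hq, hq']
          | tmul b z =>
            have hc : c₀ (y₂ ⊗ₜ z) = y₂ • (LinearMap.id : H →ₗ[k] H).rTensor H (comul z) := rfl
            simp only [TensorProduct.AlgebraTensorModule.tensorTensorTensorComm_tmul,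
              LinearMap.rTensor_tmul, TensorProduct.smul_tmul', LinearEquiv.lTensor_tmul, hc,
              LinearMap.lTensor_tmul]
            induction (comul z : H ⊗[k] H) with
            | zero => simp
            | add p q hp hq => simp only [map_add, smul_add, TensorProduct.tmul_add, hp, hq]
            | tmul z₁ z₂ => simp [L, TensorProduct.smul_tmul']
      have h₃ : translate d.gen (e' ((a ⊗ₜ y) ⊗ₜ x)) =
          d.equiv (a ⊗ₜ y) • d.gen.rTensor H (comul x) := rfl
      rw [h₃, h₁, Coalgebra.coassoc_apply, ← h₂]
      rfl

theorem isUnit_gen : IsUnit (toConv d.gen) :=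
  isUnit_of_translate_bijective d.translate_gen_bijective

theorem isCleft : letI := d.comoduleAlgebra; IsCleft k H E :=
  letI := d.comoduleAlgebra
  ⟨d.gen, d.isUnit_gen, d.coactionHom_gen⟩

theorem isComoduleEquiv :
    letI := d.comoduleAlgebra; IsComoduleEquiv k H R E d.equiv.symm := by
  let := d.comoduleAlgebra
  intro a
  obtain ⟨w, rfl⟩ := d.equiv.surjective a
  rw [LinearEquiv.symm_apply_apply]
  have h : coaction k H E (d.equiv w) = d.coactionAux w := d.coactionHom_equiv w
  rw [h, coactionAux, LinearMap.comp_apply, LinearMap.comp_apply, ← LinearMap.rTensor_comp_apply]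
  have h' : (d.equiv.symm.restrictScalars k).toLinearMap ∘ₗ
      (d.equiv.restrictScalars k).toLinearMap = LinearMap.id :=
    LinearMap.ext d.equiv.symm_apply_apply
  rw [h', LinearMap.rTensor_id]
  rfl

/-- In coordinates the hypothesis is `(id ⊗ Δ) w = w ⊗ 1`. Applying the counit to the middle factor
gives `w = r ⊗ 1`, and `r v_1` is a scalar. -/
theorem exists_of_coinvariant {a : E} (ha : d.coactionHom a = a ⊗ₜ 1) :
    ∃ r : R, algebraMap R E r = a := by
  obtain ⟨w, rfl⟩ := d.equiv.surjective a
  have h : (TensorProduct.assoc k R H H).symm ((comul (R := k) (A := H)).lTensor R w) =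
      w ⊗ₜ 1 := by
    apply ((d.equiv.restrictScalars k).rTensor H).injective
    rw [coactionHom_equiv] at ha
    exact ha
  have h₁ : ∀ w : R ⊗[k] H, counitAux.rTensor H
      ((TensorProduct.assoc k R H H).symm ((comul (R := k) (A := H)).lTensor R w)) = w := by
    intro w
    induction w with
    | zero => simp
    | add p q hp hq => simp only [map_add, hp, hq]
    | tmul r x =>
      have h₂ : ∀ y : H ⊗[k] H, counitAux.rTensor H ((TensorProduct.assoc k R H H).symm
          (r ⊗ₜ y)) = r ⊗ₜ TensorProduct.lid k H ((counit (R := k)).rTensor H y) := by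
        intro y
        induction y with
        | zero => simp
        | add p q hp hq => simp only [map_add, TensorProduct.tmul_add, hp, hq]
        | tmul y z => simp [counitAux_tmul, TensorProduct.smul_tmul']
      rw [LinearMap.lTensor_tmul, h₂, Coalgebra.rTensor_counit_comul, TensorProduct.lid_tmul,
        one_smul]
  have h₃ := h₁ w
  rw [h, LinearMap.rTensor_tmul] at h₃
  rw [← h₃]
  exact d.exists_algebraMap_eq _

theorem isGaloisExtension : letI := d.comoduleAlgebra; IsGaloisExtension k H R E := by
  let := d.comoduleAlgebra
  have hB : ∀ r : R, algebraMap R E r ∈ coinvariants k H E := d.coactionHom_algebraMap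
  refine ⟨d.algebraMap_injective, hB, fun a ha => d.exists_of_coinvariant ha, ?_⟩
  -- The map `a ⊗ x ↦ a ⊗ v_x` is onto, since scalars move across the tensor sign, and its composite
  -- with the canonical map is the bijective translation by `x ↦ v_x`. Hence the canonical map is
  -- bijective.
  let θ : E ⊗[k] H →ₗ[k] E ⊗[R] E :=
    TensorProduct.mapOfCompatibleSMul R k k E E ∘ₗ d.gen.lTensor E
  have hθ : Function.Surjective θ := by
    intro w
    induction w with
    | zero => exact ⟨0, map_zero _⟩
    | add p q hp hq =>
      obtain ⟨p, rfl⟩ := hp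
      obtain ⟨q, rfl⟩ := hq
      exact ⟨p + q, map_add _ _ _⟩
    | tmul a b =>
      obtain ⟨w, rfl⟩ := d.equiv.surjective b
      induction w with
      | zero => exact ⟨0, by simp⟩
      | add p q hp hq =>
        obtain ⟨p', hp⟩ := hp
        obtain ⟨q', hq⟩ := hq
        exact ⟨p' + q', by rw [map_add, hp, hq, map_add, TensorProduct.tmul_add]⟩
      | tmul r x =>
        refine ⟨(r • a) ⊗ₜ x, ?_⟩
        rw [d.equiv_tmul, ← TensorProduct.smul_tmul]
        rfl
  have hcan : ∀ w, canonicalMap k H hB (θ w) = translate d.gen w := by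
    intro w
    induction w with
    | zero => simp
    | add p q hp hq => simp only [map_add, hp, hq]
    | tmul a x =>
      have h : coaction k H E (d.gen x) = d.gen.rTensor H (comul x) := d.coactionHom_gen x
      refine (canonicalMap_tmul k H hB a (d.gen x)).trans ?_
      rw [h, translate_tmul]
      induction (comul x : H ⊗[k] H) with
      | zero => simp
      | add p q hp hq => simp only [map_add, smul_add, mul_add, hp, hq]
      | tmul y z => simp [TensorProduct.smul_tmul']
  constructor
  · rw [injective_iff_map_eq_zero]
    intro w hw
    obtain ⟨w, rfl⟩ := hθ w
    rw [hcan] at hw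
    rw [d.translate_gen_bijective.1 (hw.trans (map_zero _).symm), map_zero]
  · intro y
    obtain ⟨w, rfl⟩ := d.translate_gen_bijective.2 y
    exact ⟨_, hcan w⟩

end CrossedProduct

end Crossed

/-! ### Functoriality of convolution -/

section ConvolutionTools

variable {k C A A' : Type*} [Field k] [AddCommGroup C] [Module k C] [Coalgebra k C] [Ring A]
  [Algebra k A] [Ring A'] [Algebra k A']

theorem convMul_apply_of_comul_eq (f g : WithConv (C →ₗ[k] A)) {x : C}
    (hx : comul (R := k) x = x ⊗ₜ x) : (f * g) x = f x * g x := by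
  rw [LinearMap.convMul_apply, hx]
  rfl

theorem algHom_comp_convMul (h : A →ₐ[k] A') (f g : C →ₗ[k] A) :
    toConv (h.toLinearMap ∘ₗ (toConv f * toConv g).ofConv) =
      toConv (h.toLinearMap ∘ₗ f) * toConv (h.toLinearMap ∘ₗ g) := by
  rw [LinearMap.algHom_comp_convMul_distrib]

theorem algHom_comp_convOne (h : A →ₐ[k] A') :
    toConv (h.toLinearMap ∘ₗ (1 : WithConv (C →ₗ[k] A)).ofConv) = 1 := by
  ext x
  exact h.commutes _

theorem convMul_comp_mul' {H : Type*} [Ring H] [HopfAlgebra k H] (f g : H →ₗ[k] A) :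
    toConv ((toConv f * toConv g).ofConv ∘ₗ LinearMap.mul' k H) =
      toConv (f ∘ₗ LinearMap.mul' k H) * toConv (g ∘ₗ LinearMap.mul' k H) := by
  have := LinearMap.convMul_comp_coalgHom_distrib (toConv f) (toConv g) (Bialgebra.mulCoalgHom k H)
  exact congrArg toConv this

theorem convOne_comp_mul' {H : Type*} [Ring H] [HopfAlgebra k H] :
    toConv ((1 : WithConv (H →ₗ[k] A)).ofConv ∘ₗ LinearMap.mul' k H) = 1 := by
  refine WithConv.ext (LinearMap.ext fun x => congrArg (algebraMap k A) ?_)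
  induction x with
  | zero => simp
  | add a b ha hb => simp only [map_add, ha, hb]
  | tmul x y => simp [mul_comm]

/-- Convolution on `H ⊗ H` is computed factorwise, and the product `R ⊗ R → R` respects it, being an
algebra map for commutative `R`. -/
theorem tensorSquare_convMul {H : Type*} [Ring H] [HopfAlgebra k H] {R : Type*} [CommRing R]
    [Algebra k R] {f g : H →ₗ[k] R} (h : toConv f * toConv g = 1) :
    toConv (LinearMap.mul' k R ∘ₗ TensorProduct.map f f) *
      toConv (LinearMap.mul' k R ∘ₗ TensorProduct.map g g) = 1 := by
  have h₁ := TensorProduct.map_convMul_map (R := k) (f := toConv f) (h := toConv g) (g := toConv f)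
    (k := toConv g)
  have h₂ := algHom_comp_convMul (Algebra.TensorProduct.lmul' k (S := R))
    (TensorProduct.map f f) (TensorProduct.map g g)
  have h₃ : (Algebra.TensorProduct.lmul' k (S := R)).toLinearMap = LinearMap.mul' k R := rfl
  simp only at h₁
  rw [h₃, h₁, h, ofConv_toConv] at h₂
  rw [← h₂]
  ext x y
  simp [LinearMap.convOne_def, mul_comm]

end ConvolutionTools

/-! ### The product of generic elements -/

section TwistedConvolution

variable {k H : Type*} [Field k] [Ring H] [HopfAlgebra k H]

/-- For `v = f * u`, moving the commuting factors past each other gives `v(x) v(y) = f(x₁) f(y₁)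
β(x₂, y₂) u(x₃y₃)`. Inserting `g * f = ε`, evaluated on products, before the last factor turns `u`
back into `v` and leaves the cocycle `σ`, with `g` in the role of `t⁻¹`. -/
theorem twisted_convMul {K T E : Type*} [CommRing K] [Algebra k K] [Ring T] [Algebra k T] [Ring E]
    [Algebra k E] (iL : K →ₐ[k] E) (iR : T →ₐ[k] E) (hc : ∀ a b, iL a * iR b = iR b * iL a)
    (β : H ⊗[k] H →ₗ[k] k) (u : H →ₗ[k] T) (hu : ∀ x y, u x * u y = u (twistedMul β (x ⊗ₜ y)))
    (f g : H →ₗ[k] K) (hgf : toConv g * toConv f = 1) (v : H →ₗ[k] E)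
    (hv : toConv v = toConv (iL.toLinearMap ∘ₗ f) * toConv (iR.toLinearMap ∘ₗ u)) :
    toConv (LinearMap.mul' k E ∘ₗ TensorProduct.map v v) =
    toConv (iL.toLinearMap ∘ₗ (toConv (LinearMap.mul' k K ∘ₗ TensorProduct.map f f) *
      toConv (Algebra.linearMap k K ∘ₗ β) * toConv (g ∘ₗ LinearMap.mul' k H)).ofConv) *
      toConv (v ∘ₗ LinearMap.mul' k H) := by
  have h₁ := convMul_comp_mul' (iL.toLinearMap ∘ₗ f) (iR.toLinearMap ∘ₗ u)
  rw [← hv, ofConv_toConv] at h₁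
  have h₂ := convMul_comp_mul' (iL.toLinearMap ∘ₗ g) (iL.toLinearMap ∘ₗ f)
  rw [← algHom_comp_convMul, hgf, algHom_comp_convOne, convOne_comp_mul'] at h₂
  have h₃ : toConv (iL.toLinearMap ∘ₗ Algebra.linearMap k K ∘ₗ β) *
      toConv ((iR.toLinearMap ∘ₗ u) ∘ₗ LinearMap.mul' k H) =
      toConv (iR.toLinearMap ∘ₗ u ∘ₗ twistedMul β) := by
    refine WithConv.ext (LinearMap.ext fun c => ?_)
    change LinearMap.mul' k _ (TensorProduct.map _ _ (comul c)) =
      iR (u (TensorProduct.lid k H (TensorProduct.map _ _ (comul c))))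
    generalize (comul c : (H ⊗[k] H) ⊗[k] (H ⊗[k] H)) = y
    induction y with
    | zero => simp
    | add a b ha hb => simp only [map_add, ha, hb]
    | tmul a b => simp [Algebra.algebraMap_eq_smul_one]
  have h₄ : toConv (LinearMap.mul' k E ∘ₗ TensorProduct.map v v) =
      toConv (iL.toLinearMap ∘ₗ (LinearMap.mul' k K ∘ₗ TensorProduct.map f f)) *
      toConv (iR.toLinearMap ∘ₗ u ∘ₗ twistedMul β) := by
    have hv' : ∀ x, v x = LinearMap.mul' k E (TensorProduct.map (iL.toLinearMap ∘ₗ f)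
        (iR.toLinearMap ∘ₗ u) (comul x)) := fun x =>
      LinearMap.congr_fun (congrArg ofConv hv) x
    refine WithConv.ext (TensorProduct.ext' fun x y => ?_)
    change v x * v y = LinearMap.mul' k _ (TensorProduct.map _ _ (comul (x ⊗ₜ y)))
    rw [TensorProduct.comul_tmul, hv', hv']
    generalize (comul x : H ⊗[k] H) = p
    generalize (comul y : H ⊗[k] H) = q
    induction p with
    | zero => simp
    | add p p' hp hp' => simp only [map_add, add_mul, TensorProduct.add_tmul, hp, hp']
    | tmul x₁ x₂ =>
      induction q with
      | zero => simp
      | add q q' hq hq' => simp only [map_add, mul_add, TensorProduct.tmul_add, hq, hq']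
      | tmul y₁ y₂ =>
        simp only [TensorProduct.map_tmul, LinearMap.mul'_apply, LinearMap.comp_apply,
          TensorProduct.AlgebraTensorModule.tensorTensorTensorComm_tmul, AlgHom.toLinearMap_apply,
          ← hu, map_mul]
        rw [mul_assoc, ← mul_assoc (iR _), ← hc, mul_assoc, mul_assoc]
  rw [h₁, algHom_comp_convMul, ← toConv_ofConv (toConv _ * toConv (Algebra.linearMap k K ∘ₗ β)),
    algHom_comp_convMul, mul_assoc, ← mul_assoc (toConv (iL.toLinearMap ∘ₗ g ∘ₗ _))]
  rw [show iL.toLinearMap ∘ₗ g ∘ₗ LinearMap.mul' k H =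
    (iL.toLinearMap ∘ₗ g) ∘ₗ LinearMap.mul' k H from rfl, ← h₂, one_mul, mul_assoc, h₃, h₄]

end TwistedConvolution

/-! ### The generic cocycle and its inverse -/

namespace TwoCocycle

variable {k : Type u} {H : Type v} [Field k] [Ring H] [HopfAlgebra k H] (α : TwoCocycle k H)

variable (k H) in
theorem isUnit_t : IsUnit (toConv (t k H)) :=
  isUnit_toConv_generic (k := k) (C := H) (FracS k H)

theorem t_mul_tInv : toConv (t k H) * toConv (tInv k H) = 1 :=
  Ring.mul_inverse_cancel _ (isUnit_t k H)

theorem tInv_mul_t : toConv (tInv k H) * toConv (t k H) = 1 :=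
  Ring.inverse_mul_cancel _ (isUnit_t k H)

theorem toFrac_convMul (β γ : H ⊗[k] H →ₗ[k] k) (h : toConv β * toConv γ = 1) :
    toConv (toFrac β) * toConv (toFrac γ) = 1 := by
  have h₁ := algHom_comp_convMul (Algebra.ofId k (FracS k H)) β γ
  rw [h, algHom_comp_convOne] at h₁
  exact h₁.symm

/-- The six convolution factors telescope from the middle: `t⁻¹` against `t` on products, then `α`
against `α⁻¹`, then the tensor squares of `t` and `t⁻¹`. -/
theorem sigma_mul_sigmaInv : toConv α.sigma * toConv α.sigmaInv = 1 := by
  have h₁ := tensorSquare_convMul (t_mul_tInv (k := k) (H := H))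
  have h₂ := toFrac_convMul _ _ α.mul_inv
  have h₃ := convMul_comp_mul' (tInv k H) (t k H)
  rw [tInv_mul_t, convOne_comp_mul'] at h₃
  rw [sigma, sigmaInv, toConv_ofConv, toConv_ofConv, mul_assoc, mul_assoc, mul_assoc,
    ← mul_assoc (toConv (tInv k H ∘ₗ _)), ← h₃, one_mul, ← mul_assoc (toConv (toFrac α.toForm)),
    h₂, one_mul, h₁]

theorem sigmaInv_mul_sigma : toConv α.sigmaInv * toConv α.sigma = 1 := by
  have h₁ := tensorSquare_convMul (tInv_mul_t (k := k) (H := H))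
  have h₂ := toFrac_convMul _ _ α.inv_mul
  have h₃ := convMul_comp_mul' (t k H) (tInv k H)
  rw [t_mul_tInv, convOne_comp_mul'] at h₃
  rw [sigma, sigmaInv, toConv_ofConv, toConv_ofConv, mul_assoc, mul_assoc, mul_assoc,
    ← mul_assoc (toConv (LinearMap.mul' _ _ ∘ₗ _)), h₁, one_mul,
    ← mul_assoc (toConv (toFrac α.invForm)), h₂, one_mul, ← h₃]

theorem comul_one_one : comul (R := k) ((1 : H) ⊗ₜ[k] (1 : H)) = (1 ⊗ₜ 1) ⊗ₜ (1 ⊗ₜ 1) := by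
  simp [TensorProduct.comul_tmul, Algebra.TensorProduct.one_def]

theorem t_one_mul_tInv_one : t k H 1 * tInv k H 1 = 1 := by
  have h := convMul_apply_of_comul_eq (toConv (t k H)) (toConv (tInv k H)) (x := (1 : H))
    (by simp [Algebra.TensorProduct.one_def])
  rw [t_mul_tInv, LinearMap.convOne_apply, Bialgebra.counit_one, map_one] at h
  exact h.symm

theorem toForm_one_one : α.toForm (1 ⊗ₜ 1) = 1 := by
  rw [α.apply_one_left, Bialgebra.counit_one]

theorem invForm_one_one : α.invForm (1 ⊗ₜ 1) = 1 := by
  have h := convMul_apply_of_comul_eq (toConv α.toForm) (toConv α.invForm) (comul_one_one (k := k))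
  rw [α.mul_inv, LinearMap.convOne_apply] at h
  have h' : α.toForm (1 ⊗ₜ 1) * α.invForm (1 ⊗ₜ 1) = 1 := by
    refine h.symm.trans ?_
    simp
  rwa [toForm_one_one, one_mul] at h'

/-- As `1 ⊗ 1` is group-like, convolution products are evaluated there pointwise. This puts `t_1` in
`B`, and `sigmaInv_one_one` does the same for its inverse. -/
theorem sigma_one_one : α.sigma (1 ⊗ₜ 1) = t k H 1 := by
  have h₁ := convMul_apply_of_comul_eq
    (toConv (LinearMap.mul' k (FracS k H) ∘ₗ TensorProduct.map (t k H) (t k H)) *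
      toConv (toFrac α.toForm)) (toConv (tInv k H ∘ₗ LinearMap.mul' k H))
    (comul_one_one (k := k))
  have h₂ := convMul_apply_of_comul_eq
    (toConv (LinearMap.mul' k (FracS k H) ∘ₗ TensorProduct.map (t k H) (t k H)))
    (toConv (toFrac α.toForm))
    (comul_one_one (k := k))
  refine (h₁.trans (congrArg (· * _) h₂)).trans ?_
  change t k H 1 * t k H 1 * algebraMap k _ (α.toForm (1 ⊗ₜ 1)) * tInv k H (1 * 1) = _
  rw [toForm_one_one, (algebraMap k (FracS k H)).map_one, mul_one, mul_one, mul_assoc, t_one_mul_tInv_one, mul_one]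

theorem sigmaInv_one_one : α.sigmaInv (1 ⊗ₜ 1) = tInv k H 1 := by
  have h₁ := convMul_apply_of_comul_eq
    (toConv (t k H ∘ₗ LinearMap.mul' k H) * toConv (toFrac α.invForm))
    (toConv (LinearMap.mul' k (FracS k H) ∘ₗ TensorProduct.map (tInv k H) (tInv k H)))
    (comul_one_one (k := k))
  have h₂ := convMul_apply_of_comul_eq
    (toConv (t k H ∘ₗ LinearMap.mul' k H)) (toConv (toFrac α.invForm))
    (comul_one_one (k := k))
  refine (h₁.trans (congrArg (· * _) h₂)).trans ?_
  change t k H (1 * 1) * algebraMap k _ (α.invForm (1 ⊗ₜ 1)) * (tInv k H 1 * tInv k H 1) = _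
  rw [invForm_one_one, (algebraMap k (FracS k H)).map_one, mul_one, mul_one, ← mul_assoc, t_one_mul_tInv_one, one_mul]

theorem sigma_mem (c : H ⊗[k] H) : α.sigma c ∈ α.B := by
  induction c with
  | zero => rw [map_zero]; exact zero_mem _
  | add a b ha hb => rw [map_add]; exact add_mem ha hb
  | tmul x y => exact Algebra.subset_adjoin (Or.inl ⟨(x, y), rfl⟩)

theorem sigmaInv_mem (c : H ⊗[k] H) : α.sigmaInv c ∈ α.B := by
  induction c with
  | zero => rw [map_zero]; exact zero_mem _
  | add a b ha hb => rw [map_add]; exact add_mem ha hb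
  | tmul x y => exact Algebra.subset_adjoin (Or.inr ⟨(x, y), rfl⟩)

/-- The cocycle `σ` with values in the generic base algebra. -/
def sigmaB : H ⊗[k] H →ₗ[k] α.B :=
  α.sigma.codRestrict (Subalgebra.toSubmodule α.B) α.sigma_mem

/-- The inverse cocycle `σ⁻¹` with values in the generic base algebra. -/
def sigmaInvB : H ⊗[k] H →ₗ[k] α.B :=
  α.sigmaInv.codRestrict (Subalgebra.toSubmodule α.B) α.sigmaInv_mem

theorem conv_ext_B {f g : WithConv (H ⊗[k] H →ₗ[k] α.B)}
    (h : toConv (α.B.val.toLinearMap ∘ₗ f.ofConv) = toConv (α.B.val.toLinearMap ∘ₗ g.ofConv)) :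
    f = g := by
  apply ofConv_injective
  refine LinearMap.ext fun x => Subtype.ext ?_
  exact LinearMap.congr_fun (toConv_injective h) x

/-- The inverse must also have values in `B`, which is why the `σ⁻¹(x, y)` are among its generators.
-/
theorem isUnit_sigmaB : IsUnit (toConv α.sigmaB) := by
  refine ⟨⟨_, toConv α.sigmaInvB, α.conv_ext_B ?_, α.conv_ext_B ?_⟩, rfl⟩
  · rw [algHom_comp_convMul, algHom_comp_convOne]
    exact α.sigma_mul_sigmaInv
  · rw [algHom_comp_convMul, algHom_comp_convOne]
    exact α.sigmaInv_mul_sigma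

/-- The element `t⁻¹_1` of the generic base algebra. -/
def unitB : α.B := α.sigmaInvB (1 ⊗ₜ 1)

theorem coe_unitB : (α.unitB : FracS k H) = tInv k H 1 := α.sigmaInv_one_one

theorem isUnit_unitB : IsUnit α.unitB := by
  refine IsUnit.of_mul_eq_one (α.sigmaB (1 ⊗ₜ 1)) (Subtype.ext ?_)
  have h : ((α.sigmaB (1 ⊗ₜ 1) : α.B) : FracS k H) = t k H 1 := α.sigma_one_one
  change (α.unitB : FracS k H) * (α.sigmaB (1 ⊗ₜ 1) : α.B) = 1
  rw [coe_unitB, h, mul_comm, t_one_mul_tInv_one]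

/-! ### The generic twisted algebra over the field of fractions -/

/-- The scalar extension of the twisted algebra to `Frac S(t_H)`. -/
abbrev GenericTwisted : Type (max u v) := FracS k H ⊗[k] α.Twisted

/-- The isomorphism `f ⊗ x ↦ f t_{x₁} ⊗ u_{x₂}`. -/
def genericEquiv : FracS k H ⊗[k] H ≃ₗ[FracS k H] α.GenericTwisted :=
  LinearEquiv.ofBijective (translate (t k H)) (translate_bijective (isUnit_t k H)) ≪≫ₗ
    α.u.baseChange k (FracS k H) H α.Twisted

theorem genericEquiv_one_tmul (x : H) :
    α.genericEquiv (1 ⊗ₜ x) = TensorProduct.map (t k H) α.u.toLinearMap (comul x) := by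
  change α.u.baseChange k (FracS k H) H α.Twisted (translate (t k H) (1 ⊗ₜ x)) = _
  rw [translate_one_tmul]
  induction (comul x : H ⊗[k] H) with
  | zero => simp
  | add a b ha hb => simp only [map_add, ha, hb]
  | tmul y z => simp

/-- The map `x ↦ t_{x₁} ⊗ u_{x₂}`. -/
def genericGen : H →ₗ[k] α.GenericTwisted :=
  TensorProduct.map (t k H) α.u.toLinearMap ∘ₗ comul

theorem toConv_genericGen : toConv α.genericGen =
    toConv ((Algebra.TensorProduct.includeLeft : FracS k H →ₐ[k] α.GenericTwisted).toLinearMap ∘ₗ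
      t k H) *
    toConv ((Algebra.TensorProduct.includeRight : α.Twisted →ₐ[k] α.GenericTwisted).toLinearMap ∘ₗ
      α.u.toLinearMap) := by
  ext x
  rw [LinearMap.convMul_apply]
  change TensorProduct.map (t k H) α.u.toLinearMap (comul x) = _
  induction (comul x : H ⊗[k] H) with
  | zero => simp
  | add a b ha hb => simp only [map_add, ha, hb]
  | tmul y z => simp

theorem genericGen_mul :
    toConv (LinearMap.mul' k α.GenericTwisted ∘ₗ TensorProduct.map α.genericGen α.genericGen) =
    toConv ((Algebra.TensorProduct.includeLeft : FracS k H →ₐ[k] α.GenericTwisted).toLinearMap ∘ₗ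
      α.sigma) * toConv (α.genericGen ∘ₗ LinearMap.mul' k H) := by
  exact twisted_convMul (Algebra.TensorProduct.includeLeft : FracS k H →ₐ[k] α.GenericTwisted)
    (Algebra.TensorProduct.includeRight : α.Twisted →ₐ[k] α.GenericTwisted) (fun a b => by simp) α.toForm α.u.toLinearMap α.u_mul_u
    (t k H) (tInv k H) (tInv_mul_t (k := k) (H := H)) α.genericGen α.toConv_genericGen

theorem isUnit_sigma : IsUnit (toConv α.sigma) :=
  ⟨⟨_, _, α.sigma_mul_sigmaInv, α.sigmaInv_mul_sigma⟩, rfl⟩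

/-- The scalar extension of the twisted algebra, as a crossed product. -/
def genericCrossed : CrossedProduct k H (FracS k H) α.GenericTwisted where
  equiv := α.genericEquiv
  cocycle := α.sigma
  isUnit_cocycle := α.isUnit_sigma
  mul x y := by
    have h := congrArg (fun φ => φ.ofConv (x ⊗ₜ y)) α.genericGen_mul
    rw [genericEquiv_one_tmul, genericEquiv_one_tmul]
    refine h.trans ?_
    rw [translate_one_tmul]
    change LinearMap.mul' k _ (TensorProduct.map _ _ (comul (x ⊗ₜ y))) = _
    generalize (comul (x ⊗ₜ[k] y) : (H ⊗[k] H) ⊗[k] (H ⊗[k] H)) = c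
    induction c with
    | zero => simp
    | add a b ha hb => simp only [map_add, ha, hb]
    | tmul a b =>
      have e : α.sigma a ⊗ₜ[k] LinearMap.mul' k H b =
          α.sigma a • ((1 : FracS k H) ⊗ₜ[k] LinearMap.mul' k H b) := by
        rw [TensorProduct.smul_tmul', smul_eq_mul, mul_one]
      rw [LinearMap.rTensor_tmul, LinearMap.lTensor_tmul, e, map_smul, genericEquiv_one_tmul]
      exact (Algebra.smul_def (A := α.GenericTwisted) (α.sigma a)
        (α.genericGen (LinearMap.mul' k H b))).symm
  unit := tInv k H 1
  isUnit_unit := IsUnit.of_mul_eq_one (t k H 1)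
    ((mul_comm _ _).trans t_one_mul_tInv_one)
  one := by
    have e : tInv k H 1 ⊗ₜ[k] (1 : H) = tInv k H 1 • ((1 : FracS k H) ⊗ₜ[k] (1 : H)) := by
      rw [TensorProduct.smul_tmul', smul_eq_mul, mul_one]
    rw [e, map_smul, genericEquiv_one_tmul, Bialgebra.comul_one, Algebra.TensorProduct.one_def,
      TensorProduct.map_tmul, TensorProduct.smul_tmul', smul_eq_mul, mul_comm, t_one_mul_tInv_one]
    rfl

end TwoCocycle

/-! ### Specializations separate points over an infinite field -/

section SymmetricEval

variable {k V T : Type*} [Field k] [AddCommGroup V] [Module k V] [Ring T] [Algebra k T]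

/-- A basis makes `S(V)` a polynomial ring and linear forms its points, and a polynomial vanishing
at all points of an infinite field is zero. -/
theorem symmetricAlgebra_eq_zero [Infinite k] {s : SymmetricAlgebra k V}
    (h : ∀ l : V →ₗ[k] k, SymmetricAlgebra.lift l s = 0) : s = 0 := by
  let b := Module.Basis.ofVectorSpace k V
  apply (SymmetricAlgebra.equivMvPolynomial b).injective
  rw [map_zero]
  refine MvPolynomial.funext fun x => ?_
  have e : (MvPolynomial.aeval x : _ →ₐ[k] k).comp
      (SymmetricAlgebra.equivMvPolynomial b).toAlgHom = SymmetricAlgebra.lift (b.constr k x) := by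
    refine SymmetricAlgebra.algHom_ext (b.ext fun i => ?_)
    simp
  have := DFunLike.congr_fun e s
  rw [h] at this
  rw [map_zero, ← this]
  rfl

/-- The specialization `s ⊗ a ↦ χ(s) a` of `S(V) ⊗ T` at the linear form `l`, where `χ` extends
`l`. -/
def specialize (T : Type*) [Ring T] [Algebra k T] (l : V →ₗ[k] k) :
    SymmetricAlgebra k V ⊗[k] T →ₐ[k] T :=
  (Algebra.TensorProduct.lid k T).toAlgHom.comp
    (Algebra.TensorProduct.map (SymmetricAlgebra.lift l) (AlgHom.id k T))

theorem specialize_tmul (l : V →ₗ[k] k) (s : SymmetricAlgebra k V) (a : T) :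
    specialize T l (s ⊗ₜ a) = SymmetricAlgebra.lift l s • a := by
  simp [specialize]

theorem eq_zero_of_specialize [Infinite k] {w : SymmetricAlgebra k V ⊗[k] T}
    (h : ∀ l : V →ₗ[k] k, specialize T l w = 0) : w = 0 := by
  let b := Module.Basis.ofVectorSpace k T
  obtain ⟨c, rfl⟩ := TensorProduct.eq_repr_basis_right b w
  refine Finset.sum_eq_zero fun i _ => ?_
  suffices c i = 0 by simp [this]
  refine symmetricAlgebra_eq_zero fun l => ?_
  have hl := h l
  rw [Finsupp.sum, map_sum] at hl
  simp only [specialize_tmul] at hl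
  by_cases hi : i ∈ c.support
  · exact linearIndependent_iff'.1 b.linearIndependent _ _ hl i hi
  · rw [Finsupp.notMem_support_iff.1 hi, map_zero]

end SymmetricEval

/-! ### Comodule maps out of the tensor algebra -/

section ComoduleAlgHom

variable {k : Type u} {H : Type v} [Field k] [Ring H] [HopfAlgebra k H]

theorem isComoduleAlgHom_of_ι {A : Type w} [Ring A] [Algebra k A] [ComoduleAlgebra k H A]
    (f : TensorAlgebra k H →ₐ[k] A)
    (h : ∀ x : H, coaction k H A (f (TensorAlgebra.ι k x)) =
      (f.toLinearMap ∘ₗ TensorAlgebra.ι k).rTensor H (comul x)) : IsComoduleAlgHom k H f := by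
  have e : (coaction k H A).comp f = (Algebra.TensorProduct.map f (AlgHom.id k H)).comp
      (coaction k H (TensorAlgebra k H)) := by
    refine tensor_hom_ext _ _ fun x => ?_
    have h₁ : coaction k H (TensorAlgebra k H) (TensorAlgebra.ι k x) =
      (TensorAlgebra.ι k).rTensor H (comul x) := tensorCoaction_ι x
    rw [AlgHom.comp_apply, AlgHom.comp_apply, h, h₁, LinearMap.rTensor_comp_apply]
    rfl
  exact fun a => DFunLike.congr_fun e a

/-- Coassociativity makes `x ↦ l(x₁) x₂` a comodule endomorphism of `H`. These are the restrictions
of the specializations to the generators. -/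
theorem comul_contractLeft (l : H →ₗ[k] k) (x : H) :
    comul (R := k) (contractLeft H l (comul x)) =
      (contractLeft H l ∘ₗ comul).rTensor H (comul x) := by
  let L : H ⊗[k] (H ⊗[k] H) →ₗ[k] H ⊗[k] H := contractLeft (H ⊗[k] H) l
  have h₁ : ∀ y : H ⊗[k] H, comul (R := k) (contractLeft H l y) =
      L (comul.lTensor H y) := by
    intro y
    induction y with
    | zero => simp
    | add a b ha hb => simp only [map_add, ha, hb]
    | tmul a b => simp [L, contractLeft_tmul]
  have h₂ : ∀ y : H ⊗[k] H, (contractLeft H l ∘ₗ comul).rTensor H y =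
      L (TensorProduct.assoc k H H H (comul.rTensor H y)) := by
    intro y
    induction y with
    | zero => simp
    | add a b ha hb => simp only [map_add, ha, hb]
    | tmul a b =>
      simp only [LinearMap.rTensor_tmul, LinearMap.comp_apply]
      induction (comul a : H ⊗[k] H) with
      | zero => simp
      | add a b ha hb => simp only [map_add, TensorProduct.add_tmul, ha, hb]
      | tmul c d => simp [L, contractLeft_tmul, TensorProduct.smul_tmul']
  rw [h₁, h₂, Coalgebra.coassoc_apply]

end ComoduleAlgHom

/-! ### Centralizers in a scalar extension -/

section Centralizer

variable {k R T : Type*} [Field k] [CommRing R] [Algebra k R] [Ring T] [Algebra k T]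

/-- The coefficients in `T` of `w`, along a basis of `R`, are each central and hence scalars. -/
theorem exists_eq_tmul_one (hT : Subalgebra.center k T = ⊥) {w : R ⊗[k] T}
    (h : ∀ y : T, (1 ⊗ₜ y) * w = w * (1 ⊗ₜ y)) : ∃ r : R, w = r ⊗ₜ 1 := by
  let b := Module.Basis.ofVectorSpace k R
  obtain ⟨c, rfl⟩ := TensorProduct.eq_repr_basis_left b w
  have hc : ∀ i, c i ∈ Subalgebra.center k T := by
    intro i
    rw [Subalgebra.mem_center_iff]
    intro y
    have hy := h y
    rw [Finsupp.sum, Finset.mul_sum, Finset.sum_mul] at hy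
    simp only [Algebra.TensorProduct.tmul_mul_tmul, one_mul, mul_one] at hy
    rw [← sub_eq_zero, ← Finset.sum_sub_distrib] at hy
    simp only [← TensorProduct.tmul_sub] at hy
    have h0 := TensorProduct.sum_tmul_basis_left_eq_zero b
      (c.mapRange (fun x => y * x - x * y) (by simp))
      (by rw [Finsupp.sum_mapRange_index (by simp)]; exact hy)
    have hi := DFunLike.congr_fun h0 i
    rw [Finsupp.mapRange_apply] at hi
    exact sub_eq_zero.1 hi
  choose r hr using fun i => Algebra.mem_bot.1 (hT ▸ hc i)
  refine ⟨c.sum fun i _ => r i • b i, ?_⟩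
  rw [Finsupp.sum, Finsupp.sum, TensorProduct.sum_tmul]
  refine Finset.sum_congr rfl fun i _ => ?_
  rw [← hr i, Algebra.algebraMap_eq_smul_one, TensorProduct.smul_tmul]

end Centralizer

/-! ### Identities as the kernel of the universal map, and the embedding of `U` -/

namespace TwoCocycle

variable {k : Type u} {H : Type v} [Field k] [Ring H] [HopfAlgebra k H] (α : TwoCocycle k H)

theorem center_eq_bot (hα : α.Nondegenerate) : Subalgebra.center k α.Twisted = ⊥ := by
  have h : (1 : H) ≠ 0 := fun h => by
    have := Bialgebra.counit_one (R := k) (A := H)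
    rw [h, map_zero] at this
    exact zero_ne_one this
  have : Nontrivial α.Twisted := ⟨⟨α.u 1, α.u 0, fun h' => h (α.u.injective h')⟩⟩
  exact Subalgebra.eq_bot_of_finrank_one hα

theorem universalMap_ι (x : H) : α.universalMap (TensorAlgebra.ι k x) =
    TensorProduct.map (SymmetricAlgebra.ι k H) α.u.toLinearMap (comul x) :=
  TensorAlgebra.lift_ι_apply _ x

theorem specialize_universalMap_ι (l : H →ₗ[k] k) (x : H) :
    specialize α.Twisted l (α.universalMap (TensorAlgebra.ι k x)) =
      α.u (contractLeft H l (comul x)) := by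
  rw [universalMap_ι]
  induction (comul x : H ⊗[k] H) with
  | zero => simp
  | add a b ha hb => simp only [map_add, ha, hb]
  | tmul y z => simp [specialize_tmul, contractLeft_tmul]

theorem coaction_u (x : H) : coaction k H α.Twisted (α.u x) =
    α.u.toLinearMap.rTensor H (comul x) := rfl

theorem isComoduleAlgHom_specialize (l : H →ₗ[k] k) :
    IsComoduleAlgHom k H ((specialize α.Twisted l).comp α.universalMap) := by
  refine isComoduleAlgHom_of_ι _ fun x => ?_
  have h : ((specialize α.Twisted l).comp α.universalMap).toLinearMap ∘ₗ TensorAlgebra.ι k =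
      α.u.toLinearMap ∘ₗ contractLeft H l ∘ₗ comul :=
    LinearMap.ext fun x => α.specialize_universalMap_ι l x
  rw [h, AlgHom.comp_apply, specialize_universalMap_ι, coaction_u, comul_contractLeft]
  exact (LinearMap.rTensor_comp_apply _ _ _ _).symm

/-- A comodule map into `^αH` is recovered from its composite with the counit: for `l(x) =
ε(f(X_x))`, colinearity gives `f(X_x) = l(x₁) u_{x₂}`. -/
theorem exists_eq_specialize {f : TensorAlgebra k H →ₐ[k] α.Twisted}
    (hf : IsComoduleAlgHom k H f) :
    ∃ l : H →ₗ[k] k, f = (specialize α.Twisted l).comp α.universalMap := by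
  let ε' : α.Twisted →ₗ[k] k := counit ∘ₗ α.u.symm.toLinearMap
  let l : H →ₗ[k] k := ε' ∘ₗ f.toLinearMap ∘ₗ TensorAlgebra.ι k
  refine ⟨l, tensor_hom_ext _ _ fun x => ?_⟩
  rw [AlgHom.comp_apply, specialize_universalMap_ι]
  let Θ : α.Twisted ⊗[k] H →ₗ[k] α.Twisted := α.u.toLinearMap ∘ₗ contractLeft H ε'
  have h₁ : ∀ a : α.Twisted, Θ (coaction k H α.Twisted a) = a := by
    intro a
    obtain ⟨y, rfl⟩ := α.u.surjective a
    have h : ∀ q : H ⊗[k] H, contractLeft H ε' (α.u.toLinearMap.rTensor H q) =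
        TensorProduct.lid k H (counit.rTensor H q) := by
      intro q
      induction q with
      | zero => simp
      | add a b ha hb => simp only [map_add, ha, hb]
      | tmul b c => simp [ε', contractLeft_tmul]
    rw [coaction_u, LinearMap.comp_apply, h, Coalgebra.rTensor_counit_comul]
    simp
  have h₂ : coaction k H (TensorAlgebra k H) (TensorAlgebra.ι k x) =
      (TensorAlgebra.ι k).rTensor H (comul x) := tensorCoaction_ι x
  have h₃ := congrArg Θ (hf (TensorAlgebra.ι k x))
  rw [h₁, h₂] at h₃
  rw [h₃]
  induction (comul x : H ⊗[k] H) with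
  | zero => simp
  | add a b ha hb => simp only [map_add, ha, hb]
  | tmul b c => simp [Θ, l, contractLeft_tmul]

theorem mem_identities_iff [Infinite k] (P : TensorAlgebra k H) :
    P ∈ identities k H α.Twisted ↔ α.universalMap P = 0 := by
  rw [mem_identities]
  constructor
  · exact fun h => eq_zero_of_specialize fun l => h _ (α.isComoduleAlgHom_specialize l)
  · intro h f hf
    obtain ⟨l, rfl⟩ := α.exists_eq_specialize hf
    rw [AlgHom.comp_apply, h, map_zero]

/-- The inclusion `S(t_H) ⊗ ^αH → Frac S(t_H) ⊗ ^αH`. -/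
def toFracTensor : SymmetricAlgebra k H ⊗[k] α.Twisted →ₐ[k] α.GenericTwisted :=
  Algebra.TensorProduct.map (IsScalarTower.toAlgHom k (SymmetricAlgebra k H) (FracS k H))
    (AlgHom.id k α.Twisted)

theorem toFracTensor_injective : Function.Injective α.toFracTensor :=
  Module.Flat.rTensor_preserves_injective_linearMap (M := α.Twisted)
    (IsScalarTower.toAlgHom k (SymmetricAlgebra k H) (FracS k H)).toLinearMap
    (IsFractionRing.injective (SymmetricAlgebra k H) (FracS k H))

section Embedding

variable [Infinite k]

/-- The algebra map `U → S(t_H) ⊗ ^αH` induced by the universal comodule algebra map. -/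
def universalMapU : α.U →ₐ[k] SymmetricAlgebra k H ⊗[k] α.Twisted :=
  Ideal.Quotient.liftₐ (identities k H α.Twisted) α.universalMap
    fun P hP => (α.mem_identities_iff P).1 hP

theorem universalMapU_mk (P : TensorAlgebra k H) :
    α.universalMapU (Universal.mk k H α.Twisted P) = α.universalMap P := rfl

theorem universalMapU_injective : Function.Injective α.universalMapU := by
  rw [injective_iff_map_eq_zero]
  intro a ha
  obtain ⟨P, rfl⟩ := Universal.mk_surjective k H α.Twisted a
  exact Ideal.Quotient.eq_zero_iff_mem.2 ((α.mem_identities_iff P).2 ha)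

/-- The embedding of `U` into the scalar extension of the twisted algebra. -/
def embed : α.U →ₐ[k] α.GenericTwisted := α.toFracTensor.comp α.universalMapU

theorem embed_injective : Function.Injective α.embed :=
  α.toFracTensor_injective.comp α.universalMapU_injective

theorem embed_mk_ι (x : H) :
    α.embed (Universal.mk k H α.Twisted (TensorAlgebra.ι k x)) = α.genericGen x := by
  change α.toFracTensor (α.universalMap _) = TensorProduct.map _ _ (comul x)
  rw [universalMap_ι]
  induction (comul x : H ⊗[k] H) with
  | zero => simp
  | add a b ha hb => simp only [map_add, ha, hb]
  | tmul y z => rfl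

end Embedding

end TwoCocycle

/-! ### Maps out of the base change, and clearing denominators -/

section BaseChangeTools

variable {k Z B U : Type*} [Field k] [CommRing Z] [Algebra k Z] [CommRing B] [Algebra k B]
  (ι : Z →ₐ[k] B) [Ring U] [Algebra Z U]

/-- The ring map `B ⊗_Z U → E` given by two compatible commuting ring maps. -/
def BaseChange.lift {E : Type*} [Ring E] (f : B →+* E) (g : U →+* E)
    (hf : ∀ b e, f b * e = e * f b) (hfg : ∀ z, f (ι z) = g (algebraMap Z U z)) :
    BaseChange ι U →+* E :=
  letI := ι.toRingHom.toAlgebra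
  letI : Algebra Z E := RingHom.toAlgebra' (f.comp ι.toRingHom) fun z e => hf (ι z) e
  (Algebra.TensorProduct.lift (S := Z) ({ f with commutes' := fun _ => rfl } : B →ₐ[Z] E)
    ({ g with commutes' := fun z => (hfg z).symm } : U →ₐ[Z] E) fun b x => hf b (g x)).toRingHom

variable {E : Type*} [Ring E] (f : B →+* E) (g : U →+* E)
    (hf : ∀ b e, f b * e = e * f b) (hfg : ∀ z, f (ι z) = g (algebraMap Z U z))

theorem BaseChange.lift_algebraMap (b : B) :
    BaseChange.lift ι f g hf hfg (algebraMap B (BaseChange ι U) b) = f b := by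
  let := ι.toRingHom.toAlgebra
  let : Algebra Z E := RingHom.toAlgebra' (f.comp ι.toRingHom) fun z e => hf (ι z) e
  refine (Algebra.TensorProduct.lift_tmul _ _ _ b (1 : U)).trans ?_
  exact (congrArg (f b * ·) g.map_one).trans (mul_one _)

variable [Algebra k U] [IsScalarTower k Z U]

theorem BaseChange.lift_ofU (x : U) :
    BaseChange.lift ι f g hf hfg (BaseChange.ofU ι U x) = g x := by
  let := ι.toRingHom.toAlgebra
  let : Algebra Z E := RingHom.toAlgebra' (f.comp ι.toRingHom) fun z e => hf (ι z) e
  refine (Algebra.TensorProduct.lift_tmul _ _ _ (1 : B) x).trans ?_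
  exact (congrArg (· * g x) f.map_one).trans (one_mul _)

theorem BaseChange.ofU_algebraMap (z : Z) :
    BaseChange.ofU ι U (algebraMap Z U z) = algebraMap B (BaseChange ι U) (ι z) := by
  let := ι.toRingHom.toAlgebra
  change (1 : B) ⊗ₜ[Z] algebraMap Z U z = ι z ⊗ₜ[Z] (1 : U)
  rw [Algebra.algebraMap_eq_smul_one, ← TensorProduct.smul_tmul, Algebra.smul_def, mul_one]
  rfl

theorem BaseChange.induction {p : BaseChange ι U → Prop} (h0 : p 0)
    (hadd : ∀ a b, p a → p b → p (a + b))
    (h : ∀ (b : B) (x : U), p (b • BaseChange.ofU ι U x)) (a : BaseChange ι U) : p a := by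
  let := ι.toRingHom.toAlgebra
  refine TensorProduct.induction_on (motive := p) a h0 (fun b x => ?_) hadd
  have := h b x
  have e : b • BaseChange.ofU ι U x = (b ⊗ₜ[Z] x : B ⊗[Z] U) := by
    change b • ((1 : B) ⊗ₜ[Z] x) = _
    rw [TensorProduct.smul_tmul', smul_eq_mul, mul_one]
  rwa [e] at this

/-- If `B` is a localization of `Z`, every element of `B ⊗_Z U` is a fraction. -/
theorem BaseChange.exists_smul_eq (h : IsLocalizationMap ι.toRingHom) (a : BaseChange ι U) :
    ∃ (m : Z) (x : U), IsUnit (ι m) ∧ ι m • a = BaseChange.ofU ι U x := by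
  obtain ⟨M, hM⟩ := h
  let := ι.toRingHom.toAlgebra
  have hu : ∀ m : M, IsUnit (ι m) := fun m => IsLocalization.map_units B m
  have key : ∀ (z : Z) (x : U), ι z • BaseChange.ofU ι U x =
      BaseChange.ofU ι U (algebraMap Z U z * x) := by
    intro z x
    rw [map_mul, BaseChange.ofU_algebraMap, Algebra.smul_def]
  induction a using BaseChange.induction with
  | h0 => exact ⟨1, 0, by rw [map_one]; exact isUnit_one, by rw [smul_zero, map_zero]⟩
  | hadd a b ha hb =>
    obtain ⟨m, x, hm, hx⟩ := ha
    obtain ⟨n, y, hn, hy⟩ := hb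
    refine ⟨m * n, algebraMap Z U n * x + algebraMap Z U m * y, by rw [map_mul]; exact hm.mul hn, ?_⟩
    rw [map_add, ← key, ← key, smul_add, map_mul, ← hx, ← hy, smul_smul, smul_smul,
      mul_comm (ι n)]
  | h b x =>
    obtain ⟨⟨z, m⟩, hzm⟩ := IsLocalization.surj M b
    refine ⟨m, algebraMap Z U z * x, hu m, ?_⟩
    have e : ι m * b = ι z := (mul_comm _ _).trans hzm
    rw [smul_smul, e, key]

end BaseChangeTools

/-! ### Scalars and commutation in the generic twisted algebra -/

namespace TwoCocycle

variable {k : Type u} {H : Type v} [Field k] [Ring H] [HopfAlgebra k H] (α : TwoCocycle k H)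

theorem smul_eq_algebraMap_mul (f : FracS k H) (a : α.GenericTwisted) :
    f • a = algebraMap (FracS k H) α.GenericTwisted f * a :=
  Algebra.smul_def f a

theorem genericEquiv_tmul (f : FracS k H) (x : H) :
    α.genericEquiv (f ⊗ₜ x) = algebraMap (FracS k H) α.GenericTwisted f * α.genericGen x := by
  have h := α.genericCrossed.equiv_tmul f x
  rw [smul_eq_algebraMap_mul] at h
  refine h.trans ?_
  exact congrArg _ (α.genericEquiv_one_tmul x)

theorem genericAlgebraMap_injective :
    Function.Injective (algebraMap (FracS k H) α.GenericTwisted) :=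
  α.genericCrossed.algebraMap_injective

theorem genericAlgebraMap_commute (f : FracS k H) (a : α.GenericTwisted) :
    algebraMap (FracS k H) α.GenericTwisted f * a = a * algebraMap (FracS k H) _ f :=
  Algebra.commutes f a

/-- The `v_x` span the algebra over the central field `Frac S(t_H)`. -/
theorem commute_of_commute_genericGen {a : α.GenericTwisted}
    (h : ∀ x, α.genericGen x * a = a * α.genericGen x) (y : α.GenericTwisted) :
    y * a = a * y := by
  obtain ⟨w, rfl⟩ := α.genericEquiv.surjective y
  induction w with
  | zero => rw [LinearEquiv.map_zero, zero_mul, mul_zero]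
  | add p q hp hq => rw [LinearEquiv.map_add, add_mul, mul_add, hp, hq]
  | tmul f x =>
    rw [genericEquiv_tmul, mul_assoc, h, ← mul_assoc, genericAlgebraMap_commute, mul_assoc]

theorem exists_algebraMap_of_commute (hα : α.Nondegenerate) {a : α.GenericTwisted}
    (h : ∀ x, α.genericGen x * a = a * α.genericGen x) :
    ∃ f : FracS k H, a = algebraMap (FracS k H) α.GenericTwisted f :=
  exists_eq_tmul_one (α.center_eq_bot hα) fun y => α.commute_of_commute_genericGen h (1 ⊗ₜ y)

/-! ### The span of the generic elements over the generic base algebra -/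

/-- The map `b ⊗ x ↦ b t_{x₁} ⊗ u_{x₂}` on `B ⊗ H`. -/
def baseMap : α.B ⊗[k] H →ₗ[k] α.GenericTwisted :=
  (α.genericEquiv.restrictScalars k).toLinearMap ∘ₗ α.B.val.toLinearMap.rTensor H

theorem baseMap_tmul (b : α.B) (x : H) : α.baseMap (b ⊗ₜ x) =
    algebraMap (FracS k H) α.GenericTwisted b * α.genericGen x :=
  α.genericEquiv_tmul b x

theorem baseMap_injective : Function.Injective α.baseMap :=
  α.genericEquiv.injective.comp
    (Module.Flat.rTensor_preserves_injective_linearMap _ Subtype.val_injective)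

theorem translate_sigmaB (b : α.B) (c : H ⊗[k] H) :
    α.B.val.toLinearMap.rTensor H ((LinearMap.mul' k H).lTensor α.B
      (translate α.sigmaB (b ⊗ₜ c))) =
    (LinearMap.mul' k H).lTensor (FracS k H) (translate α.sigma ((b : FracS k H) ⊗ₜ c)) := by
  rw [translate_tmul, translate_tmul]
  generalize (comul c : (H ⊗[k] H) ⊗[k] (H ⊗[k] H)) = y
  induction y with
  | zero => simp
  | add p q hp hq => simp only [map_add, smul_add, hp, hq]
  | tmul p q =>
    simp only [LinearMap.rTensor_tmul, TensorProduct.smul_tmul', LinearMap.lTensor_tmul]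
    rfl

theorem baseMap_mul_baseMap (a b : α.B) (x y : H) :
    α.baseMap (a ⊗ₜ x) * α.baseMap (b ⊗ₜ y) = α.baseMap ((LinearMap.mul' k H).lTensor α.B
      (translate α.sigmaB ((a * b) ⊗ₜ (x ⊗ₜ y)))) := by
  have h := α.genericCrossed.equiv_mul_equiv (a : FracS k H) b x y
  refine h.trans (congrArg α.genericEquiv ?_)
  exact (α.translate_sigmaB (a * b) (x ⊗ₜ y)).symm

theorem baseMap_unitB : α.baseMap (α.unitB ⊗ₜ 1) = 1 := by
  refine (congrArg (fun f => α.genericEquiv (f ⊗ₜ 1)) α.coe_unitB).trans ?_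
  exact α.genericCrossed.one

/-- The image of `B ⊗ H`. -/
def baseSpan : Subalgebra k α.GenericTwisted where
  carrier := Set.range α.baseMap
  mul_mem' := by
    rintro _ _ ⟨p, rfl⟩ ⟨q, rfl⟩
    induction p with
    | zero => exact ⟨0, by rw [map_zero, zero_mul]⟩
    | add p p' hp hp' =>
      rw [map_add, add_mul]
      exact (LinearMap.range α.baseMap).add_mem hp hp'
    | tmul a x =>
      induction q with
      | zero => exact ⟨0, by rw [map_zero, mul_zero]⟩
      | add q q' hq hq' =>
        rw [map_add, mul_add]
        exact (LinearMap.range α.baseMap).add_mem hq hq'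
      | tmul b y => exact ⟨_, (α.baseMap_mul_baseMap a b x y).symm⟩
  add_mem' := by
    rintro _ _ ⟨p, rfl⟩ ⟨q, rfl⟩
    exact ⟨p + q, map_add _ _ _⟩
  algebraMap_mem' r := by
    refine ⟨r • (α.unitB ⊗ₜ 1), ?_⟩
    rw [map_smul, baseMap_unitB, Algebra.algebraMap_eq_smul_one]

/-- Since `v_1 = t_1 ⊗ u_1`, one has `b = (b t_1⁻¹) v_1`, and `t_1⁻¹` lies in `B`. -/
theorem algebraMap_mem_baseSpan (b : α.B) :
    algebraMap (FracS k H) α.GenericTwisted b ∈ α.baseSpan := by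
  refine ⟨(b * α.unitB) ⊗ₜ 1, ?_⟩
  have h := α.baseMap_unitB
  rw [baseMap_tmul] at h
  rw [baseMap_tmul]
  change algebraMap (FracS k H) α.GenericTwisted (b * α.unitB) * _ = _
  rw [map_mul, mul_assoc, h, mul_one]

theorem genericGen_mem_baseSpan (x : H) : α.genericGen x ∈ α.baseSpan :=
  ⟨1 ⊗ₜ x, by
    rw [baseMap_tmul]
    change algebraMap (FracS k H) α.GenericTwisted 1 * _ = _
    rw [map_one, one_mul]⟩

/-- The coordinate of `f` is `f t_1⁻¹ ⊗ 1`. If it comes from `B ⊗ H`, applying the counit gives `f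
t_1⁻¹ ∈ B`, and `t_1 ∈ B`. Both the values of `ι` and the center of `B ⊗_Z U` are placed in `B` in
this way. -/
theorem mem_B_of_mem_baseSpan {f : FracS k H}
    (hf : algebraMap (FracS k H) α.GenericTwisted f ∈ α.baseSpan) : f ∈ α.B := by
  obtain ⟨w, hw⟩ := hf
  have h₁ := α.genericCrossed.algebraMap_eq f
  have h₂ : α.B.val.toLinearMap.rTensor H w = (f * tInv k H 1) ⊗ₜ 1 :=
    α.genericEquiv.injective (hw.trans h₁)
  have h₃ : ∀ w : α.B ⊗[k] H, CrossedProduct.counitAux (α.B.val.toLinearMap.rTensor H w) ∈ α.B := by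
    intro w
    induction w with
    | zero => rw [map_zero, map_zero]; exact zero_mem _
    | add p q hp hq => rw [map_add, map_add]; exact add_mem hp hq
    | tmul b x =>
      rw [LinearMap.rTensor_tmul, CrossedProduct.counitAux_tmul]
      exact α.B.smul_mem b.2 _
  have h₄ := h₃ w
  rw [h₂, CrossedProduct.counitAux_tmul, Bialgebra.counit_one, one_smul] at h₄
  have h₅ : t k H 1 ∈ α.B := α.sigma_one_one ▸ α.sigma_mem (1 ⊗ₜ 1)
  have h₆ := mul_mem h₄ h₅
  rwa [mul_assoc, mul_comm (tInv k H 1), t_one_mul_tInv_one, mul_one] at h₆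

theorem iota_ext {b c : α.B} (h : algebraMap (FracS k H) α.GenericTwisted b =
    algebraMap (FracS k H) α.GenericTwisted c) : b = c :=
  Subtype.ext (α.genericAlgebraMap_injective h)

section Infinite

variable [Infinite k]

theorem embed_mem_baseSpan (a : α.U) : α.embed a ∈ α.baseSpan := by
  obtain ⟨P, rfl⟩ := Universal.mk_surjective k H α.Twisted a
  induction P using TensorAlgebra.induction with
  | algebraMap r =>
    rw [AlgHom.commutes, AlgHom.commutes]
    exact α.baseSpan.algebraMap_mem r
  | ι x => rw [embed_mk_ι]; exact α.genericGen_mem_baseSpan x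
  | mul a b ha hb => rw [map_mul, map_mul]; exact mul_mem ha hb
  | add a b ha hb => rw [map_add, map_add]; exact add_mem ha hb

theorem embed_commute (z : α.Z) (y : α.GenericTwisted) :
    y * α.embed (algebraMap α.Z α.U z) = α.embed (algebraMap α.Z α.U z) * y := by
  refine α.commute_of_commute_genericGen (fun x => ?_) y
  rw [← embed_mk_ι, ← map_mul, ← map_mul]
  exact congrArg α.embed (Center.valRingHom_commute k α.U z _).symm

/-- The centralizer argument is run over `S(t_H)` instead of its fraction field, so that the scalar
is a polynomial. Commutation with `1 ⊗ y` can be tested after the injection into `Frac S(t_H) ⊗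
^αH`. -/
theorem exists_universalMapU_eq (hα : α.Nondegenerate) (z : α.Z) :
    ∃ s : SymmetricAlgebra k H, α.universalMapU (algebraMap α.Z α.U z) = s ⊗ₜ 1 := by
  refine exists_eq_tmul_one (α.center_eq_bot hα) fun y => α.toFracTensor_injective ?_
  rw [map_mul, map_mul]
  exact α.embed_commute z _

theorem exists_iota (hα : α.Nondegenerate) (z : α.Z) : ∃ b : α.B,
    algebraMap (FracS k H) α.GenericTwisted b = α.embed (algebraMap α.Z α.U z) := by
  obtain ⟨s, hs⟩ := α.exists_universalMapU_eq hα z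
  have h : algebraMap (FracS k H) α.GenericTwisted (algebraMap (SymmetricAlgebra k H) _ s) =
      α.embed (algebraMap α.Z α.U z) := (congrArg α.toFracTensor hs).symm
  exact ⟨⟨_, α.mem_B_of_mem_baseSpan (h ▸ α.embed_mem_baseSpan _)⟩, h⟩

/-- The value of the algebra map `Z → B`. -/
def iotaFun (hα : α.Nondegenerate) (z : α.Z) : α.B := (α.exists_iota hα z).choose

theorem algebraMap_iotaFun (hα : α.Nondegenerate) (z : α.Z) :
    algebraMap (FracS k H) α.GenericTwisted (α.iotaFun hα z) =
      α.embed (algebraMap α.Z α.U z) := (α.exists_iota hα z).choose_spec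

/-- The algebra map `Z → B`. -/
def iota (hα : α.Nondegenerate) : α.Z →ₐ[k] α.B where
  toFun := α.iotaFun hα
  map_one' := α.iota_ext (by
    rw [algebraMap_iotaFun, map_one, map_one]
    exact (map_one _).symm)
  map_mul' x y := α.iota_ext (by
    change _ = algebraMap (FracS k H) α.GenericTwisted
      ((α.iotaFun hα x : FracS k H) * (α.iotaFun hα y : FracS k H))
    rw [RingHom.map_mul, algebraMap_iotaFun, algebraMap_iotaFun, algebraMap_iotaFun, map_mul,
      map_mul])
  map_zero' := α.iota_ext (by
    rw [algebraMap_iotaFun, map_zero, map_zero]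
    exact (map_zero _).symm)
  map_add' x y := α.iota_ext (by
    change _ = algebraMap (FracS k H) α.GenericTwisted
      ((α.iotaFun hα x : FracS k H) + (α.iotaFun hα y : FracS k H))
    rw [RingHom.map_add, algebraMap_iotaFun, algebraMap_iotaFun, algebraMap_iotaFun, map_add,
      map_add])
  commutes' r := α.iota_ext (by
    rw [algebraMap_iotaFun, ← IsScalarTower.algebraMap_apply k α.Z α.U, AlgHom.commutes]
    exact (IsScalarTower.algebraMap_apply k (FracS k H) α.GenericTwisted r))

theorem algebraMap_iota (hα : α.Nondegenerate) (z : α.Z) :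
    algebraMap (FracS k H) α.GenericTwisted (α.iota hα z) =
      α.embed (algebraMap α.Z α.U z) := α.algebraMap_iotaFun hα z

theorem iota_spec (hα : α.Nondegenerate) (z : α.Z) (P : TensorAlgebra k H)
    (hP : Universal.mk k H α.Twisted P = algebraMap α.Z α.U z) :
    ∃ s : SymmetricAlgebra k H, α.universalMap P = s ⊗ₜ 1 ∧
      (α.iota hα z : FracS k H) = algebraMap (SymmetricAlgebra k H) _ s := by
  obtain ⟨s, hs⟩ := α.exists_universalMapU_eq hα z
  refine ⟨s, ?_, α.genericAlgebraMap_injective ?_⟩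
  · rw [← hs, ← hP, universalMapU_mk]
  · rw [algebraMap_iota]
    exact congrArg α.toFracTensor hs

/-! ### The base change of `U` to the generic base algebra -/

variable (hα : α.Nondegenerate)

/-- The central localization `B ⊗_Z U`. -/
abbrev Localized : Type (max u v) := BaseChange (α.iota hα) α.U

/-- The map from `B ⊗_Z U` to the scalar extension of the twisted algebra. -/
def localizedMap : α.Localized hα →+* α.GenericTwisted :=
  BaseChange.lift (α.iota hα) ((algebraMap (FracS k H) α.GenericTwisted).comp α.B.val.toRingHom)
    α.embed.toRingHom (fun _ _ => α.genericAlgebraMap_commute _ _) (α.algebraMap_iota hα)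

theorem localizedMap_algebraMap (b : α.B) :
    α.localizedMap hα (algebraMap α.B _ b) = algebraMap (FracS k H) α.GenericTwisted b :=
  BaseChange.lift_algebraMap _ _ _ _ _ b

theorem localizedMap_ofU (x : α.U) :
    α.localizedMap hα (BaseChange.ofU (α.iota hα) α.U x) = α.embed x :=
  BaseChange.lift_ofU _ _ _ _ _ x

theorem localizedMap_smul (b : α.B) (a : α.Localized hα) :
    α.localizedMap hα (b • a) =
      algebraMap (FracS k H) α.GenericTwisted b * α.localizedMap hα a := by
  rw [Algebra.smul_def, map_mul, localizedMap_algebraMap]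

/-- The generating map `x ↦ 1 ⊗ X_x`. -/
def localizedGen : H →ₗ[k] α.Localized hα :=
  (BaseChange.ofU (α.iota hα) α.U).toLinearMap ∘ₗ (Universal.mk k H α.Twisted).toLinearMap ∘ₗ
    TensorAlgebra.ι k

theorem localizedMap_gen (x : H) :
    α.localizedMap hα (α.localizedGen hα x) = α.genericGen x :=
  (α.localizedMap_ofU hα _).trans (α.embed_mk_ι x)

/-- Some `ι(m)`, a unit of `B`, carries a kernel element into the image of `U`, where injectivity of
`embed` applies. -/
theorem localizedMap_injective (h : IsLocalizationMap (α.iota hα).toRingHom) :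
    Function.Injective (α.localizedMap hα) := by
  rw [injective_iff_map_eq_zero]
  intro a ha
  obtain ⟨m, x, hm, hx⟩ := BaseChange.exists_smul_eq (α.iota hα) h a
  have h₁ := congrArg (α.localizedMap hα) hx
  rw [localizedMap_smul, ha, mul_zero, localizedMap_ofU] at h₁
  rw [α.embed_injective (h₁.symm.trans (map_zero _).symm), map_zero] at hx
  obtain ⟨c, hc⟩ := hm.exists_left_inv
  rw [← one_smul α.B a, ← hc, mul_smul, hx, smul_zero]

theorem localizedMap_mem_baseSpan (a : α.Localized hα) : α.localizedMap hα a ∈ α.baseSpan := by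
  induction a using BaseChange.induction with
  | h0 => rw [map_zero]; exact zero_mem _
  | hadd a b ha hb => rw [map_add]; exact add_mem ha hb
  | h b x =>
    rw [localizedMap_smul, localizedMap_ofU]
    exact mul_mem (α.algebraMap_mem_baseSpan b) (α.embed_mem_baseSpan x)

/-- The map `b ⊗ x ↦ b ⊗ X_x`. -/
def localizedLinear : α.B ⊗[k] H →ₗ[α.B] α.Localized hα :=
  TensorProduct.AlgebraTensorModule.lift
    (LinearMap.toSpanSingleton α.B (H →ₗ[k] α.Localized hα) (α.localizedGen hα))

theorem localizedLinear_tmul (b : α.B) (x : H) :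
    α.localizedLinear hα (b ⊗ₜ x) = b • α.localizedGen hα x := rfl

theorem localizedMap_linear (w : α.B ⊗[k] H) :
    α.localizedMap hα (α.localizedLinear hα w) = α.baseMap w := by
  induction w with
  | zero => simp
  | add p q hp hq => simp only [map_add, hp, hq]
  | tmul b x => rw [localizedLinear_tmul, localizedMap_smul, localizedMap_gen, baseMap_tmul]

variable (h : IsLocalizationMap (α.iota hα).toRingHom)

/-- The isomorphism `b ⊗ x ↦ b ⊗ X_x`. -/
def localizedEquiv : α.B ⊗[k] H ≃ₗ[α.B] α.Localized hα :=
  LinearEquiv.ofBijective (α.localizedLinear hα) <| by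
    constructor
    · intro p q hpq
      apply α.baseMap_injective
      rw [← localizedMap_linear, ← localizedMap_linear, hpq]
    · intro a
      obtain ⟨w, hw⟩ := α.localizedMap_mem_baseSpan hα a
      refine ⟨w, α.localizedMap_injective hα h ?_⟩
      rw [localizedMap_linear, hw]

theorem localizedMap_equiv (w : α.B ⊗[k] H) :
    α.localizedMap hα (α.localizedEquiv hα h w) = α.baseMap w :=
  α.localizedMap_linear hα w

/-- The crossed product structure of the central localization. -/
def localizedCrossed : CrossedProduct k H α.B (α.Localized hα) where
  equiv := α.localizedEquiv hα h
  cocycle := α.sigmaB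
  isUnit_cocycle := α.isUnit_sigmaB
  mul x y := by
    -- The relation is inherited from the generic twisted algebra, where it holds with `σ`, whose
    -- values are in `B`.
    apply α.localizedMap_injective hα h
    rw [map_mul, localizedMap_equiv, localizedMap_equiv, localizedMap_equiv, baseMap_mul_baseMap,
      mul_one]
  unit := α.unitB
  isUnit_unit := α.isUnit_unitB
  one := by
    apply α.localizedMap_injective hα h
    rw [localizedMap_equiv, baseMap_unitB, map_one]

theorem localizedCrossed_gen (x : H) :
    (α.localizedCrossed hα h).gen x = α.localizedGen hα x :=
  (α.localizedLinear_tmul hα 1 x).trans (one_smul _ _)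

theorem isComoduleAlgHom_ofU :
    letI := (α.localizedCrossed hα h).comoduleAlgebra
    IsComoduleAlgHom k H (BaseChange.ofU (α.iota hα) α.U) := by
  let := (α.localizedCrossed hα h).comoduleAlgebra
  have hT : IsComoduleAlgHom k H
      ((BaseChange.ofU (α.iota hα) α.U).comp (Universal.mk k H α.Twisted)) := by
    refine isComoduleAlgHom_of_ι _ fun x => ?_
    have h₁ := (α.localizedCrossed hα h).coactionHom_gen x
    have h₂ : (α.localizedCrossed hα h).gen = α.localizedGen hα :=
      LinearMap.ext (α.localizedCrossed_gen hα h)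
    rw [h₂] at h₁
    exact h₁
  intro a
  obtain ⟨P, rfl⟩ := Universal.mk_surjective k H α.Twisted a
  refine (hT P).trans ?_
  have h₃ : coaction k H α.U (Universal.mk k H α.Twisted P) =
      (Universal.mk k H α.Twisted).toLinearMap.rTensor H (coaction k H (TensorAlgebra k H) P) :=
    universalCoaction_mk P
  rw [h₃, ← LinearMap.rTensor_comp_apply]
  rfl

/-- The image of a central element commutes with every `v_x`, so it is a scalar by non-degeneracy;
lying in the `B`-span of the `v_x`, it is in `B`. -/
theorem center_localized (h : IsLocalizationMap (α.iota hα).toRingHom) :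
    Subalgebra.center α.B (α.Localized hα) = ⊥ := by
  rw [eq_bot_iff]
  intro a ha
  rw [Subalgebra.mem_center_iff] at ha
  obtain ⟨f, hf⟩ := α.exists_algebraMap_of_commute hα (a := α.localizedMap hα a) fun x => by
    rw [← α.localizedMap_gen hα, ← map_mul, ← map_mul, ha]
  have hfB := α.mem_B_of_mem_baseSpan (hf ▸ α.localizedMap_mem_baseSpan hα a)
  refine Algebra.mem_bot.2 ⟨⟨f, hfB⟩, α.localizedMap_injective hα h ?_⟩
  rw [localizedMap_algebraMap, hf]

theorem rank_localized (h : IsLocalizationMap (α.iota hα).toRingHom) :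
    Module.rank α.B (α.Localized hα) =
    Cardinal.lift.{u} (Module.rank k H) := by
  rw [← (α.localizedEquiv hα h).rank_eq, Module.rank_baseChange, Cardinal.lift_umax.{v, u}]

end Infinite

end TwoCocycle

end HopfIdent

end

/-! ### The theorem -/

theorem mainTheorem1 {k : Type u} {H : Type v} [Field k] [Infinite k] [Ring H] [HopfAlgebra k H]
    (α : TwoCocycle k H) (hα : α.Nondegenerate) :
    IsUnit (WithConv.toConv (TwoCocycle.t k H)) ∧
    ∃ ι : α.Z →ₐ[k] α.B,
      (∀ (z : α.Z) (P : TensorAlgebra k H),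
        Universal.mk k H α.Twisted P = algebraMap α.Z α.U z →
          ∃ s : SymmetricAlgebra k H, α.universalMap P = s ⊗ₜ 1 ∧
            (ι z : TwoCocycle.FracS k H) = algebraMap (SymmetricAlgebra k H) _ s) ∧
      (IsLocalizationMap ι.toRingHom →
        ∃ _ : ComoduleAlgebra k H (BaseChange ι α.U),
          (∀ b : α.B, coaction k H (BaseChange ι α.U) (algebraMap α.B _ b) =
            algebraMap α.B _ b ⊗ₜ 1) ∧
          IsComoduleAlgHom k H (BaseChange.ofU ι α.U) ∧
          IsGaloisExtension k H α.B (BaseChange ι α.U) ∧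
          IsCleft k H (BaseChange ι α.U) ∧
          (∃ e : BaseChange ι α.U ≃ₗ[α.B] α.B ⊗[k] H,
            IsComoduleEquiv k H α.B (BaseChange ι α.U) e) ∧
          Subalgebra.center α.B (BaseChange ι α.U) = ⊥ ∧
          Module.Free α.B (BaseChange ι α.U) ∧
          Module.rank α.B (BaseChange ι α.U) = Cardinal.lift.{u} (Module.rank k H)) := by
  -- The first component certifies that the `Ring.inverse` in `tInv` is a genuine inverse and not
  -- its default value.
  refine ⟨TwoCocycle.isUnit_t k H, α.iota hα, α.iota_spec hα, fun h => ?_⟩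
  refine ⟨(α.localizedCrossed hα h).comoduleAlgebra,
    (α.localizedCrossed hα h).coactionHom_algebraMap, α.isComoduleAlgHom_ofU hα h,
    (α.localizedCrossed hα h).isGaloisExtension, (α.localizedCrossed hα h).isCleft,
    ⟨_, (α.localizedCrossed hα h).isComoduleEquiv⟩, α.center_localized hα h,
    Module.Free.of_equiv (α.localizedEquiv hα h), α.rank_localized hα h⟩
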